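/- Let $\kappa\in(0,8)\setminus\mathbb{Q}$ and $q=e^{4\pi i/\kappa}$, and write $[2]=q+q^{-1}$. Let $\mathcal{U}_q(\mathfrak{sl}_2)$ be the unital associative $\mathbb{C}$-algebra generated by $E,F,K,K^{-1}$ with relations $KK^{-1}=1=K^{-1}K$, $KE=q^2EK$, $KF=q^{-2}FK$, $EF-FE=\frac{K-K^{-1}}{q-q^{-1}}$, with coproduct $\Delta(E)=E\otimes K+1\otimes E$, $\Delta(K)=K\otimes K$, $\Delta(F)=F\otimes 1+K^{-1}\otimes F$. Let $\mathsf{M}_2$ be its representation with basis $e_0,e_1$ and $Ke_0=qe_0$, $Ke_1=q^{-1}e_1$, $Fe_0=e_1$, $Fe_1=0$, $Ee_0=0$, $Ee_1=e_0$. The coproduct makes each $\mathsf{M}_2^{\otimes n}$ a representation, with $\mathsf{M}_2^{\otimes 0}=\mathbb{C}$ the trivial one, and we set $$\mathsf{H}_1=\mathsf{H}_1(\mathsf{M}_2^{\otimes 2N})=\{v\in \mathsf{M}_2^{\otimes 2N}: E.v=0,\ K.v=v\}.$$ Let $s=\frac{1}{q-q^{-1}}(e_1\otimes e_0-q\,e_0\otimes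 e_1)$, let $\hat\pi:\mathsf{M}_2\otimes\mathsf{M}_2\to\mathbb{C}$ be the linear map with $\hat\pi(s)=1$ and $\hat\pi(F^l.(e_0\otimes e_0))=0$ for $l=0,1,2$, and let $\hat\pi_j:\mathsf{M}_2^{\otimes n}\to\mathsf{M}_2^{\otimes(n-2)}$ ($1\le j\le n-1$) be $\hat\pi$ acting on the tensor components $j$ and $j+1$ counted from the right. For $N\ge 0$ let $\mathrm{LP}_N$ be the set of link patterns with $N$ links, i.e. non-crossing partitions of $\{1,\dots,2N\}$ into pairs (links) $\{a,b\}$, $a<b$. If $\{j,j+1\}\in\alpha\in\mathrm{LP}_N$, let $\alpha/\{j,j+1\}\in\mathrm{LP}_{N-1}$ be obtained by removing this link and reducing all indices greater than $j+1$ by two. An ordering $\sigma$ of the links of $\alpha$, say $\{a_1,b_1\},\dots,\{a_N,b_N\}$, is allowable if the links can be removed one after another in this order: for each $j$, after removal of the first $j-1$ links and relabeling, the $j$-th link has become $\{a_j(j-1),b_j(j-1)\}$ with $b_j(j-1)=a_j(j-1)+1$. For an allowable ordering define $$\psi_\alpha^{(\sigma)}=\hat\pi_{a_N(N-1)}\circ\cdots\circ\hat\pi_{a_2(1)}\circ\hat\pi_{a_1}:\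 \mathsf{H}_1\to\mathbb{C}.$$ Let $(v_\alpha)$, indexed by all link patterns $\alpha\in\bigsqcup_{N\ge0}\mathrm{LP}_N$, be the collection of vectors $v_\alpha\in\mathsf{M}_2^{\otimes 2N}$ ($\alpha\in\mathrm{LP}_N$) with $v_\emptyset=1$, $K.v_\alpha=v_\alpha$, $E.v_\alpha=0$ and, for all $1\le j\le 2N-1$, $\hat\pi_j(v_\alpha)=v_{\alpha/\{j,j+1\}}$ if $\{j,j+1\}\in\alpha$ and $\hat\pi_j(v_\alpha)=0$ otherwise. Then this collection exists and is unique, and for every $N\ge0$ the following hold. (a) Every $\alpha\in\mathrm{LP}_N$ has an allowable ordering, and $\psi_\alpha^{(\sigma)}=\psi_\alpha^{(\sigma')}$ for any two allowable orderings $\sigma,\sigma'$ of $\alpha$. Thus $\psi_\alpha:=\psi_\alpha^{(\sigma)}\in\mathsf{H}_1^*$ is well defined. (b) For all $\alpha,\beta\in\mathrm{LP}_N$ we have $\psi_\alpha(v_\beta)=\delta_{\alpha,\beta}$. In particular $(v_\alpha)_{\alpha\in\mathrm{LP}_N}$ is a basis of $\mathsf{H}_1(\mathsf{M}_2^{\otimes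 2N})$ and $(\psi_\alpha)_{\alpha\in\mathrm{LP}_N}$ is a basis of $\mathsf{H}_1^*$, and they are dual to each other. Both spaces have dimension equal to the Catalan number $\mathrm{C}_N=\frac{1}{N+1}\binom{2N}{N}$. -/

import Mathlib

open scoped TensorProduct

namespace PureSLE

noncomputable section

/-! ## The deformation parameter -/

/-- Admissible deformation parameters: nonzero complex numbers that are not roots of unity. -/
def DefParam : Type := {q : ℂ // q ≠ 0 ∧ ∀ n : ℕ, 0 < n → q ^ n ≠ 1}

instance : CoeOut DefParam ℂ := ⟨Subtype.val⟩

theorem DefParam.ne_zero (q : DefParam) : (q : ℂ) ≠ 0 := q.2.1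

theorem DefParam.sub_inv_ne_zero (q : DefParam) : (q : ℂ) - (q : ℂ)⁻¹ ≠ 0 := by
  intro h
  apply q.2.2 2 (by norm_num)
  have h0 := q.ne_zero
  have h1 : (q : ℂ) = (q : ℂ)⁻¹ := sub_eq_zero.mp h
  have h2 : (q : ℂ) * q = 1 := by
    nth_rewrite 2 [h1]
    exact mul_inv_cancel₀ h0
  rw [pow_two]
  exact h2

/-- The parameter `q = exp (4 π i / κ)` attached to an irrational `κ`. -/
def qOf (κ : ℝ) (hκ : Irrational κ) : DefParam :=
  ⟨Complex.exp (4 * Real.pi * Complex.I / κ), Complex.exp_ne_zero _, by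
    intro n hn h
    rw [← Complex.exp_nat_mul, Complex.exp_eq_one_iff] at h
    obtain ⟨m, hm⟩ := h
    have hκ0 : κ ≠ 0 := hκ.ne_zero
    have hκc : (κ : ℂ) ≠ 0 := by exact_mod_cast hκ0
    have hpi : (Real.pi : ℂ) ≠ 0 := by exact_mod_cast Real.pi_ne_zero
    have e1 : (2 * n : ℂ) = m * κ := by
      have hI := Complex.I_ne_zero
      field_simp at hm
      linear_combination hm / 2
    have e2 : (2 * n : ℝ) = m * κ := by exact_mod_cast e1
    have hm0 : (m : ℝ) ≠ 0 := by
      intro h0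
      rw [h0, zero_mul] at e2
      have : (0 : ℝ) < n := by exact_mod_cast hn
      linarith
    apply hκ
    refine ⟨(2 * n : ℚ) / m, ?_⟩
    push_cast
    rw [e2]
    field_simp⟩

/-- The `q`-integer `[m]`. -/
def qnum (q : DefParam) (m : ℤ) : ℂ :=
  ((q : ℂ) ^ m - (q : ℂ) ^ (-m)) / ((q : ℂ) - (q : ℂ)⁻¹)

/-! ## The quantum group `U_q(sl₂)` -/

/-- Names of the generators. -/
inductive Gen : Type
  | E | F | K | Kinv

/-- The free algebra on the generators. -/
abbrev FreeGen : Type := FreeAlgebra ℂ Gen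

/-- The defining relations of `U_q(sl₂)`. -/
inductive UqRel (q : DefParam) : FreeGen → FreeGen → Prop
  | K_Kinv : UqRel q (FreeAlgebra.ι ℂ Gen.K * FreeAlgebra.ι ℂ Gen.Kinv) 1
  | Kinv_K : UqRel q (FreeAlgebra.ι ℂ Gen.Kinv * FreeAlgebra.ι ℂ Gen.K) 1
  | K_E : UqRel q (FreeAlgebra.ι ℂ Gen.K * FreeAlgebra.ι ℂ Gen.E)
      (((q : ℂ) ^ 2) • (FreeAlgebra.ι ℂ Gen.E * FreeAlgebra.ι ℂ Gen.K))
  | K_F : UqRel q (FreeAlgebra.ι ℂ Gen.K * FreeAlgebra.ι ℂ Gen.F)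
      ((((q : ℂ) ^ 2)⁻¹) • (FreeAlgebra.ι ℂ Gen.F * FreeAlgebra.ι ℂ Gen.K))
  | E_F : UqRel q
      (FreeAlgebra.ι ℂ Gen.E * FreeAlgebra.ι ℂ Gen.F - FreeAlgebra.ι ℂ Gen.F * FreeAlgebra.ι ℂ Gen.E)
      ((((q : ℂ) - (q : ℂ)⁻¹)⁻¹) • (FreeAlgebra.ι ℂ Gen.K - FreeAlgebra.ι ℂ Gen.Kinv))

/-- The associative unital algebra `U_q(sl₂)` over `ℂ`. -/
abbrev Uq (q : DefParam) : Type := RingQuot (UqRel q)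

/-- The generators as elements of `U_q(sl₂)`. -/
def gen (q : DefParam) (x : Gen) : Uq q := RingQuot.mkAlgHom ℂ (UqRel q) (FreeAlgebra.ι ℂ x)

/-- The universal property of `U_q(sl₂)`: images of the generators that satisfy the relations
determine an algebra homomorphism. -/
def Uq.lift (q : DefParam) {A : Type*} [Ring A] [Algebra ℂ A] (f : Gen → A)
    (h1 : f Gen.K * f Gen.Kinv = 1) (h2 : f Gen.Kinv * f Gen.K = 1)
    (h3 : f Gen.K * f Gen.E = ((q : ℂ) ^ 2) • (f Gen.E * f Gen.K))
    (h4 : f Gen.K * f Gen.F = (((q : ℂ) ^ 2)⁻¹) • (f Gen.F * f Gen.K))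
    (h5 : f Gen.E * f Gen.F - f Gen.F * f Gen.E
      = (((q : ℂ) - (q : ℂ)⁻¹)⁻¹) • (f Gen.K - f Gen.Kinv)) : Uq q →ₐ[ℂ] A :=
  RingQuot.liftAlgHom ℂ ⟨FreeAlgebra.lift ℂ f, by
    intro x y hxy
    cases hxy <;> simp [*]⟩

@[simp]
theorem Uq.lift_gen (q : DefParam) {A : Type*} [Ring A] [Algebra ℂ A] (f : Gen → A)
    (h1 : f Gen.K * f Gen.Kinv = 1) (h2 : f Gen.Kinv * f Gen.K = 1)
    (h3 : f Gen.K * f Gen.E = ((q : ℂ) ^ 2) • (f Gen.E * f Gen.K))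
    (h4 : f Gen.K * f Gen.F = (((q : ℂ) ^ 2)⁻¹) • (f Gen.F * f Gen.K))
    (h5 : f Gen.E * f Gen.F - f Gen.F * f Gen.E
      = (((q : ℂ) - (q : ℂ)⁻¹)⁻¹) • (f Gen.K - f Gen.Kinv)) (x : Gen) :
    Uq.lift q f h1 h2 h3 h4 h5 (gen q x) = f x := by
  simp [Uq.lift, gen]

theorem K_Kinv (q : DefParam) : gen q Gen.K * gen q Gen.Kinv = 1 := by
  simpa [gen] using RingQuot.mkAlgHom_rel ℂ (UqRel.K_Kinv (q := q))

theorem Kinv_K (q : DefParam) : gen q Gen.Kinv * gen q Gen.K = 1 := by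
  simpa [gen] using RingQuot.mkAlgHom_rel ℂ (UqRel.Kinv_K (q := q))

theorem K_E (q : DefParam) :
    gen q Gen.K * gen q Gen.E = ((q : ℂ) ^ 2) • (gen q Gen.E * gen q Gen.K) := by
  simpa [gen] using RingQuot.mkAlgHom_rel ℂ (UqRel.K_E (q := q))

theorem K_F (q : DefParam) :
    gen q Gen.K * gen q Gen.F = (((q : ℂ) ^ 2)⁻¹) • (gen q Gen.F * gen q Gen.K) := by
  simpa [gen] using RingQuot.mkAlgHom_rel ℂ (UqRel.K_F (q := q))

theorem E_F (q : DefParam) :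
    gen q Gen.E * gen q Gen.F - gen q Gen.F * gen q Gen.E
      = (((q : ℂ) - (q : ℂ)⁻¹)⁻¹) • (gen q Gen.K - gen q Gen.Kinv) := by
  simpa [gen] using RingQuot.mkAlgHom_rel ℂ (UqRel.E_F (q := q))

theorem Kinv_E (q : DefParam) :
    gen q Gen.E * gen q Gen.Kinv = ((q : ℂ) ^ 2) • (gen q Gen.Kinv * gen q Gen.E) := by
  calc gen q Gen.E * gen q Gen.Kinv
      = (gen q Gen.Kinv * gen q Gen.K) * gen q Gen.E * gen q Gen.Kinv := by
        rw [Kinv_K, one_mul]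
    _ = gen q Gen.Kinv * (gen q Gen.K * gen q Gen.E) * gen q Gen.Kinv := by
        simp only [mul_assoc]
    _ = ((q : ℂ) ^ 2) • (gen q Gen.Kinv * gen q Gen.E * (gen q Gen.K * gen q Gen.Kinv)) := by
        rw [K_E]; simp only [mul_smul_comm, smul_mul_assoc, mul_assoc]
    _ = _ := by rw [K_Kinv, mul_one]

/-- The coproduct on the generators. -/
def comulGen (q : DefParam) : Gen → Uq q ⊗[ℂ] Uq q
  | Gen.E => gen q Gen.E ⊗ₜ gen q Gen.K + 1 ⊗ₜ gen q Gen.E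
  | Gen.F => gen q Gen.F ⊗ₜ 1 + gen q Gen.Kinv ⊗ₜ gen q Gen.F
  | Gen.K => gen q Gen.K ⊗ₜ gen q Gen.K
  | Gen.Kinv => gen q Gen.Kinv ⊗ₜ gen q Gen.Kinv

/-- The coproduct `Δ : U_q(sl₂) → U_q(sl₂) ⊗ U_q(sl₂)`. -/
def comul (q : DefParam) : Uq q →ₐ[ℂ] Uq q ⊗[ℂ] Uq q :=
  Uq.lift q (comulGen q)
    (by simp [comulGen, K_Kinv, Algebra.TensorProduct.one_def])
    (by simp [comulGen, Kinv_K, Algebra.TensorProduct.one_def])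
    (by simp [comulGen, K_E, mul_add, add_mul, TensorProduct.smul_tmul'])
    (by simp [comulGen, K_F, mul_add, add_mul, TensorProduct.smul_tmul', K_Kinv, Kinv_K])
    (by
      have hq : ((q : ℂ) ^ 2) ≠ 0 := pow_ne_zero 2 q.ne_zero
      have key : (gen q Gen.E * gen q Gen.Kinv) ⊗ₜ[ℂ] (gen q Gen.K * gen q Gen.F)
          = (gen q Gen.Kinv * gen q Gen.E) ⊗ₜ[ℂ] (gen q Gen.F * gen q Gen.K) := by
        rw [Kinv_E, K_F, TensorProduct.smul_tmul_smul, mul_inv_cancel₀ hq, one_smul]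
      have e1 : gen q Gen.E * gen q Gen.F = gen q Gen.F * gen q Gen.E
          + (((q : ℂ) - (q : ℂ)⁻¹)⁻¹) • (gen q Gen.K - gen q Gen.Kinv) := by
        rw [← E_F]; abel
      simp only [comulGen, mul_add, add_mul, Algebra.TensorProduct.tmul_mul_tmul, one_mul, mul_one,
        key]
      rw [e1]
      simp only [TensorProduct.add_tmul, TensorProduct.tmul_add, TensorProduct.tmul_smul,
        ← TensorProduct.smul_tmul', TensorProduct.sub_tmul, TensorProduct.tmul_sub, smul_sub]
      abel)

/-- The counit: the action on the trivial one-dimensional representation. -/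
def counit (q : DefParam) : Uq q →ₐ[ℂ] ℂ :=
  Uq.lift q (fun x => match x with
    | Gen.E => 0
    | Gen.F => 0
    | Gen.K => 1
    | Gen.Kinv => 1) (by simp) (by simp) (by simp) (by simp) (by simp)

/-! ## Representations -/

/-- The tensor product of two representations, formed with the coproduct. -/
def tensorRep (q : DefParam) {M M' : Type*} [AddCommGroup M] [Module ℂ M] [AddCommGroup M']
    [Module ℂ M'] (ρ : Uq q →ₐ[ℂ] Module.End ℂ M) (ρ' : Uq q →ₐ[ℂ] Module.End ℂ M') :
    Uq q →ₐ[ℂ] Module.End ℂ (M ⊗[ℂ] M') :=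
  (Module.endTensorEndAlgHom.comp (Algebra.TensorProduct.map ρ ρ')).comp (comul q)

/-- The underlying space of the two-dimensional representation `M₂`, with basis `e 0`, `e 1`. -/
abbrev M2 : Type := Fin 2 → ℂ

/-- The basis vectors of `M₂`. -/
def e (l : Fin 2) : M2 := Pi.single l 1

/-- The action of the generators on `M₂`: `K e₀ = q e₀`, `K e₁ = q⁻¹ e₁`, `F e₀ = e₁`, `F e₁ = 0`,
`E e₀ = 0`, `E e₁ = e₀`, as matrices in the basis `e 0`, `e 1`. -/
def matM2 (q : DefParam) : Gen → Matrix (Fin 2) (Fin 2) ℂ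
  | Gen.E => !![0, 1; 0, 0]
  | Gen.F => !![0, 0; 1, 0]
  | Gen.K => !![(q : ℂ), 0; 0, (q : ℂ)⁻¹]
  | Gen.Kinv => !![(q : ℂ)⁻¹, 0; 0, (q : ℂ)]

/-- The representation `M₂`. -/
def repM2 (q : DefParam) : Uq q →ₐ[ℂ] Module.End ℂ M2 :=
  (Matrix.toLinAlgEquiv' (R := ℂ) (n := Fin 2)).toAlgHom.comp <|
    Uq.lift q (matM2 q)
      (by have h := q.ne_zero; ext i j; fin_cases i <;> fin_cases j <;> simp [matM2, h])
      (by have h := q.ne_zero; ext i j; fin_cases i <;> fin_cases j <;> simp [matM2, h])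
      (by have h := q.ne_zero; ext i j; fin_cases i <;> fin_cases j <;> simp [matM2]; field_simp)
      (by have h := q.ne_zero; ext i j; fin_cases i <;> fin_cases j <;> simp [matM2]; field_simp)
      (by
        have h := q.sub_inv_ne_zero
        have h' : (q : ℂ)⁻¹ - q = -((q : ℂ) - (q : ℂ)⁻¹) := by ring
        ext i j
        fin_cases i <;> fin_cases j
        · simp [matM2, inv_mul_cancel₀ h]
        · simp [matM2]
        · simp [matM2]
        · simp only [matM2]
          simp [h', inv_mul_cancel₀ h, -neg_sub])

/-- The tensor power `M₂^{⊗ n}`. -/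
abbrev TPow (n : ℕ) : Type := ⨂[ℂ]^n M2

/-- The identification `M₂^{⊗ n} ⊗ M₂ = M₂^{⊗ (n+1)}`, adding a tensorand on the right. -/
def snoc (n : ℕ) : TPow n ⊗[ℂ] M2 ≃ₗ[ℂ] TPow (n + 1) :=
  (TensorProduct.congr (LinearEquiv.refl ℂ (TPow n))
    (PiTensorProduct.subsingletonEquiv (R := ℂ) (s := fun _ : Fin 1 => M2) (0 : Fin 1)).symm).trans
    (TensorPower.mulEquiv (R := ℂ) (M := M2) (n := n) (m := 1))

theorem snoc_tprod (n : ℕ) (x : Fin n → M2) (y : M2) :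
    snoc n (PiTensorProduct.tprod ℂ x ⊗ₜ y)
      = PiTensorProduct.tprod ℂ (Fin.snoc (α := fun _ => M2) x y) := by
  have h : (PiTensorProduct.subsingletonEquiv (R := ℂ) (s := fun _ : Fin 1 => M2) (0 : Fin 1)).symm y
      = PiTensorProduct.tprod ℂ (fun _ : Fin 1 => y) := by
    rw [LinearEquiv.symm_apply_eq]; simp
  have h2 := TensorPower.tprod_mul_tprod ℂ x (fun _ : Fin 1 => y)
  rw [Fin.append_right_eq_snoc] at h2
  simp only [snoc, LinearEquiv.trans_apply, TensorProduct.congr_tmul, LinearEquiv.refl_apply, h]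
  exact h2

/-- The identification `M₂^{⊗ 0} = ℂ`. -/
def scalar : TPow 0 ≃ₗ[ℂ] ℂ := PiTensorProduct.isEmptyEquiv (Fin 0)

/-- The representation of `U_q(sl₂)` on `M₂^{⊗ n}`: trivial for `n = 0`, and given by iterating
the coproduct in general. -/
def rep (q : DefParam) : (n : ℕ) → Uq q →ₐ[ℂ] Module.End ℂ (TPow n)
  | 0 => (Algebra.ofId ℂ (Module.End ℂ (TPow 0))).comp (counit q)
  | n + 1 => ((snoc n).conjAlgEquiv ℂ).toAlgHom.comp (tensorRep q (rep q n) (repM2 q))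

/-- The trivial subrepresentation `H₁(M₂^{⊗ n}) = {v | E.v = 0, K.v = v}`. -/
def H1 (q : DefParam) (n : ℕ) : Submodule ℂ (TPow n) where
  carrier := {v | rep q n (gen q Gen.E) v = 0 ∧ rep q n (gen q Gen.K) v = v}
  zero_mem' := by simp
  add_mem' := by
    rintro a b ⟨h1, h2⟩ ⟨h3, h4⟩
    exact ⟨by rw [map_add, h1, h3, add_zero], by rw [map_add, h2, h4]⟩
  smul_mem' := by
    rintro c a ⟨h1, h2⟩
    exact ⟨by rw [map_smul, h1, smul_zero], by rw [map_smul, h2]⟩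

/-! ## Singlet projections -/

/-- The singlet vector `s ∈ M₂ ⊗ M₂`. -/
def singlet (q : DefParam) : M2 ⊗[ℂ] M2 :=
  (((q : ℂ) - (q : ℂ)⁻¹)⁻¹) • (e 1 ⊗ₜ[ℂ] e 0 - (q : ℂ) • e 0 ⊗ₜ[ℂ] e 1)

/-- The triplet vectors `τ_l = F^l.(e₀ ⊗ e₀)`, `l = 0, 1, 2`. -/
def triplet (q : DefParam) (l : ℕ) : M2 ⊗[ℂ] M2 :=
  tensorRep q (repM2 q) (repM2 q) (gen q Gen.F ^ l) (e 0 ⊗ₜ[ℂ] e 0)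

/-- The projection `π̂ : M₂ ⊗ M₂ → ℂ` to the singlet, given by its values on the basis
`e i ⊗ e j`. It is the linear map with `π̂(s) = 1` and `π̂(τ_l) = 0` for `l = 0, 1, 2`,
see `singletProj_unique`. -/
def singletProj (q : DefParam) : M2 ⊗[ℂ] M2 →ₗ[ℂ] ℂ :=
  TensorProduct.lift (LinearMap.mk₂ ℂ
    (fun x y => (((q : ℂ)⁻¹ - q) / qnum q 2) * (x 0 * y 1)
      + ((1 - ((q : ℂ) ^ 2)⁻¹) / qnum q 2) * (x 1 * y 0))
    (by intros; simp; ring) (by intros; simp; ring) (by intros; simp; ring)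
    (by intros; simp; ring))

theorem qnum_two (q : DefParam) : qnum q 2 = (q : ℂ) + (q : ℂ)⁻¹ := by
  rw [qnum, div_eq_iff q.sub_inv_ne_zero]
  have h := q.ne_zero
  rw [zpow_neg]
  simp only [zpow_ofNat]
  field_simp
  ring

theorem qnum_two_ne_zero (q : DefParam) : (q : ℂ) + (q : ℂ)⁻¹ ≠ 0 := by
  intro h
  apply q.2.2 4 (by norm_num)
  have h0 := q.ne_zero
  have h1 : (q : ℂ) ^ 2 + 1 = 0 := by
    have : (q : ℂ) * (q + (q : ℂ)⁻¹) = 0 := by rw [h, mul_zero]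
    rw [mul_add, mul_inv_cancel₀ h0] at this
    rw [pow_two]; exact this
  change (q : ℂ) ^ 4 = 1
  linear_combination ((q : ℂ) ^ 2 - 1) * h1

theorem singletProj_singlet (q : DefParam) : singletProj q (singlet q) = 1 := by
  have h0 := q.ne_zero
  have h1 := q.sub_inv_ne_zero
  have h2 := qnum_two_ne_zero q
  simp only [singletProj, singlet, map_smul, map_sub, TensorProduct.lift.tmul, LinearMap.mk₂_apply,
    qnum_two, e, smul_eq_mul]
  simp
  rw [inv_mul_eq_iff_eq_mul₀ h1, mul_one]
  rw [← mul_div_assoc, ← sub_div, div_eq_iff h2]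
  field_simp
  ring

theorem repM2_F (q : DefParam) (x : M2) : repM2 q (gen q Gen.F) x = (x 0) • e 1 := by
  ext i
  fin_cases i <;> simp [repM2, matM2, e, Matrix.toLinAlgEquiv'_apply, Matrix.mulVec, dotProduct]

theorem repM2_Kinv (q : DefParam) (x : M2) :
    repM2 q (gen q Gen.Kinv) x = ((q : ℂ)⁻¹ * x 0) • e 0 + ((q : ℂ) * x 1) • e 1 := by
  ext i
  fin_cases i <;> simp [repM2, matM2, e, Matrix.toLinAlgEquiv'_apply, Matrix.mulVec, dotProduct]

theorem tensorRep_F (q : DefParam) (x y : M2) :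
    tensorRep q (repM2 q) (repM2 q) (gen q Gen.F) (x ⊗ₜ[ℂ] y)
      = repM2 q (gen q Gen.F) x ⊗ₜ[ℂ] y
        + repM2 q (gen q Gen.Kinv) x ⊗ₜ[ℂ] repM2 q (gen q Gen.F) y := by
  simp [tensorRep, comul, comulGen, Module.endTensorEndAlgHom_apply]

theorem triplet_zero (q : DefParam) : triplet q 0 = e 0 ⊗ₜ[ℂ] e 0 := by
  simp [triplet]

theorem triplet_one (q : DefParam) :
    triplet q 1 = (q : ℂ)⁻¹ • e 0 ⊗ₜ[ℂ] e 1 + e 1 ⊗ₜ[ℂ] e 0 := by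
  simp [triplet, tensorRep_F, repM2_F, repM2_Kinv, e, TensorProduct.smul_tmul']
  abel

theorem triplet_two (q : DefParam) : triplet q 2 = qnum q 2 • e 1 ⊗ₜ[ℂ] e 1 := by
  have h : triplet q 2 = tensorRep q (repM2 q) (repM2 q) (gen q Gen.F) (triplet q 1) := by
    simp [triplet, pow_succ]
  rw [h, triplet_one, qnum_two]
  simp only [map_add, map_smul, tensorRep_F, repM2_F, repM2_Kinv]
  simp [e, add_smul, TensorProduct.smul_tmul']
  abel

theorem singletProj_triplet (q : DefParam) (l : Fin 3) : singletProj q (triplet q l) = 0 := by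
  have h0 := q.ne_zero
  have h2 := qnum_two_ne_zero q
  fin_cases l
  · simp [triplet_zero, singletProj, e]
  · simp only [triplet_one, singletProj, map_add, map_smul, TensorProduct.lift.tmul,
      LinearMap.mk₂_apply, e, qnum_two]
    simp
    field_simp
    ring
  · simp [triplet_two, singletProj, e]

theorem singletProj_unique (q : DefParam) (f : M2 ⊗[ℂ] M2 →ₗ[ℂ] ℂ) (hs : f (singlet q) = 1)
    (ht : ∀ l : Fin 3, f (triplet q l) = 0) : f = singletProj q := by
  have h0 := q.ne_zero
  have h1 := q.sub_inv_ne_zero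
  have h2 := qnum_two_ne_zero q
  have key : ∀ g : M2 ⊗[ℂ] M2 →ₗ[ℂ] ℂ, g (singlet q) = 0 → (∀ l : Fin 3, g (triplet q l) = 0) →
      ∀ i j : Fin 2, g (e i ⊗ₜ[ℂ] e j) = 0 := by
    intro g gs gt
    have t0 := gt 0
    have t1 := gt 1
    have t2 := gt 2
    change g (triplet q 0) = 0 at t0
    change g (triplet q 1) = 0 at t1
    change g (triplet q 2) = 0 at t2
    rw [triplet_zero] at t0
    rw [triplet_one, map_add, map_smul, smul_eq_mul] at t1
    rw [triplet_two, map_smul, qnum_two, smul_eq_mul] at t2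
    rw [singlet, map_smul, map_sub, map_smul, smul_eq_mul, smul_eq_mul] at gs
    have gs' := (mul_eq_zero.mp gs).resolve_left (inv_ne_zero h1)
    have a : g (e 0 ⊗ₜ[ℂ] e 1) = 0 := by
      have : ((q : ℂ) + (q : ℂ)⁻¹) * g (e 0 ⊗ₜ[ℂ] e 1) = 0 := by linear_combination t1 - gs'
      exact (mul_eq_zero.mp this).resolve_left h2
    have b : g (e 1 ⊗ₜ[ℂ] e 0) = 0 := by
      rw [a] at gs'; simpa using gs'
    have c : g (e 1 ⊗ₜ[ℂ] e 1) = 0 := (mul_eq_zero.mp t2).resolve_left h2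
    intro i j
    fin_cases i <;> fin_cases j
    · exact t0
    · exact a
    · exact b
    · exact c
  have hz := key (f - singletProj q)
    (by rw [LinearMap.sub_apply, hs, singletProj_singlet, sub_self])
    (by intro l; rw [LinearMap.sub_apply, ht, singletProj_triplet, sub_self])
  rw [← sub_eq_zero]
  refine TensorProduct.ext (LinearMap.pi_ext' fun i => LinearMap.ext_ring ?_)
  refine LinearMap.pi_ext' fun j => LinearMap.ext_ring ?_
  exact hz i j

/-- The projection `π̂_j : M₂^{⊗ (n+2)} → M₂^{⊗ n}`, which applies `π̂` to the tensor components
`j` and `j + 1` counted from the right, for `1 ≤ j ≤ n + 1` (and is zero for other `j`). -/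
def piHat (q : DefParam) : (n j : ℕ) → TPow (n + 2) →ₗ[ℂ] TPow n
  | _, 0 => 0
  | n, 1 =>
      (TensorProduct.rid ℂ (TPow n)).toLinearMap ∘ₗ
        (singletProj q).lTensor (TPow n) ∘ₗ
        (TensorProduct.assoc ℂ (TPow n) M2 M2).toLinearMap ∘ₗ
        (snoc n).symm.toLinearMap.rTensor M2 ∘ₗ
        (snoc (n + 1)).symm.toLinearMap
  | 0, _ + 2 => 0
  | n + 1, j + 2 =>
      (snoc n).toLinearMap ∘ₗ (piHat q n (j + 1)).rTensor M2 ∘ₗ (snoc (n + 2)).symm.toLinearMap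

/-! ## Link patterns -/

/-- Link patterns of `N` links: planar (non-crossing) pair partitions of `{1, …, 2N}`. A link is
a pair `(a, b)` with `a < b`. -/
@[ext]
structure LinkPattern (N : ℕ) where
  /-- the set of links -/
  links : Finset (ℕ × ℕ)
  range : ∀ l ∈ links, 1 ≤ l.1 ∧ l.1 < l.2 ∧ l.2 ≤ 2 * N
  partition : ∀ i, 1 ≤ i → i ≤ 2 * N → ∃! l, l ∈ links ∧ (l.1 = i ∨ l.2 = i)
  planar : ∀ l ∈ links, ∀ m ∈ links, l ≠ m →
    0 < ((l.1 : ℤ) - m.1) * (l.2 - m.2) * (l.2 - m.1) * (l.1 - m.2)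

instance (N : ℕ) : DecidableEq (LinkPattern N) := fun _ _ =>
  decidable_of_iff _ LinkPattern.ext_iff.symm

/-- The empty link pattern. -/
def LinkPattern.empty : LinkPattern 0 where
  links := ∅
  range := by simp
  partition := by intro i h1 h2; omega
  planar := by simp

/-- Relabeling of an index after the removal of the link `(j, j+1)`: indices greater than `j + 1`
are reduced by two. -/
def relabel (j i : ℕ) : ℕ := if j + 1 < i then i - 2 else i

/-- Relabeling of both endpoints of a link. -/
def relabelLink (j : ℕ) (l : ℕ × ℕ) : ℕ × ℕ := (relabel j l.1, relabel j l.2)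

theorem sign_relabel (j x y : ℕ) (hx : x ≠ j) (hx' : x ≠ j + 1) (hy : y ≠ j) (hy' : y ≠ j + 1) :
    SignType.sign ((relabel j x : ℤ) - relabel j y) = SignType.sign ((x : ℤ) - y) := by
  rcases lt_trichotomy x y with h | h | h
  · rw [sign_neg (a := (x : ℤ) - y) (by omega), sign_neg]
    unfold relabel; split_ifs <;> omega
  · subst h; simp
  · rw [sign_pos (a := (x : ℤ) - y) (by omega), sign_pos]
    unfold relabel; split_ifs <;> omega

theorem LinkPattern.endpoint_ne {N : ℕ} (α : LinkPattern N) {j : ℕ} (h : (j, j + 1) ∈ α.links)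
    {l : ℕ × ℕ} (hl : l ∈ α.links) (hne : l ≠ (j, j + 1)) :
    (l.1 ≠ j ∧ l.1 ≠ j + 1) ∧ (l.2 ≠ j ∧ l.2 ≠ j + 1) := by
  have hp := α.planar l hl _ h hne
  refine ⟨⟨?_, ?_⟩, ⟨?_, ?_⟩⟩ <;> intro hc <;> simp [hc] at hp

/-- The link pattern `α / (j, j+1)` obtained by removing the link `(j, j+1)` from `α`. -/
def LinkPattern.remove {N : ℕ} (α : LinkPattern (N + 1)) (j : ℕ) (h : (j, j + 1) ∈ α.links) :
    LinkPattern N where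
  links := (α.links.erase (j, j + 1)).image (relabelLink j)
  range := by
    intro l hl
    simp only [Finset.mem_image, Finset.mem_erase] at hl
    obtain ⟨m, ⟨hne, hm⟩, rfl⟩ := hl
    have h1 := α.range m hm
    have h2 := α.range _ h
    have h3 := α.endpoint_ne h hm hne
    simp only [relabelLink, relabel]
    simp only at h2
    split_ifs <;> omega
  partition := by
    intro i hi1 hi2
    have h2 := α.range _ h
    simp only at h2
    obtain ⟨i', hi', hi'1, hi'2⟩ : ∃ i', i' = (if i < j then i else i + 2) ∧ 1 ≤ i' ∧
        i' ≤ 2 * (N + 1) := ⟨_, rfl, by split_ifs <;> omega, by split_ifs <;> omega⟩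
    have hinv : ∀ k, k ≠ j → k ≠ j + 1 → (relabel j k = i ↔ k = i') := by
      intro k hk hk'
      rw [hi']
      unfold relabel
      split_ifs <;> omega
    obtain ⟨l, ⟨hl, hli⟩, huniq⟩ := α.partition i' hi'1 hi'2
    have hne : l ≠ (j, j + 1) := by
      rintro rfl
      simp only at hli
      rw [hi'] at hli
      split_ifs at hli <;> omega
    have hle := α.endpoint_ne h hl hne
    refine ⟨relabelLink j l, ⟨Finset.mem_image_of_mem _ (Finset.mem_erase.mpr ⟨hne, hl⟩), ?_⟩, ?_⟩
    · simp only [relabelLink]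
      rw [hinv _ hle.1.1 hle.1.2, hinv _ hle.2.1 hle.2.2]
      exact hli
    · rintro m ⟨hm, hmi⟩
      simp only [Finset.mem_image, Finset.mem_erase] at hm
      obtain ⟨m', ⟨hne', hm'⟩, rfl⟩ := hm
      have hme := α.endpoint_ne h hm' hne'
      simp only [relabelLink] at hmi
      rw [hinv _ hme.1.1 hme.1.2, hinv _ hme.2.1 hme.2.2] at hmi
      rw [huniq m' ⟨hm', hmi⟩]
  planar := by
    intro l hl m hm hlm
    simp only [Finset.mem_image, Finset.mem_erase] at hl hm
    obtain ⟨l', ⟨hle, hl'⟩, rfl⟩ := hl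
    obtain ⟨m', ⟨hme, hm'⟩, rfl⟩ := hm
    have hl3 := α.endpoint_ne h hl' hle
    have hm3 := α.endpoint_ne h hm' hme
    have hp := α.planar l' hl' m' hm' (by rintro rfl; exact hlm rfl)
    rw [← sign_eq_one_iff] at hp ⊢
    simp only [sign_mul, relabelLink] at hp ⊢
    rw [sign_relabel _ _ _ hl3.1.1 hl3.1.2 hm3.1.1 hm3.1.2,
      sign_relabel _ _ _ hl3.2.1 hl3.2.2 hm3.2.1 hm3.2.2,
      sign_relabel _ _ _ hl3.2.1 hl3.2.2 hm3.1.1 hm3.1.2,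
      sign_relabel _ _ _ hl3.1.1 hl3.1.2 hm3.2.1 hm3.2.2]
    exact hp

/-! ## The vectors `v_α` -/

/-- The system of equations for a collection `(v_α)` of vectors `v_α ∈ M₂^{⊗ 2|α|}` indexed by
all link patterns: `K.v_α = v_α`, `E.v_α = 0`, the conditions on the projections `π̂_j(v_α)` for
`1 ≤ j ≤ 2|α| - 1`, and the normalization `v_∅ = 1`. -/
structure IsPureSystem (q : DefParam) (v : (N : ℕ) → LinkPattern N → TPow (2 * N)) : Prop where
  K_eq : ∀ N (α : LinkPattern N), rep q (2 * N) (gen q Gen.K) (v N α) = v N α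
  E_eq : ∀ N (α : LinkPattern N), rep q (2 * N) (gen q Gen.E) (v N α) = 0
  proj_of_notMem : ∀ N (α : LinkPattern (N + 1)) (j : ℕ), 1 ≤ j → j ≤ 2 * (N + 1) - 1 →
    (j, j + 1) ∉ α.links → piHat q (2 * N) j (v (N + 1) α) = 0
  proj_of_mem : ∀ N (α : LinkPattern (N + 1)) (j : ℕ) (h : (j, j + 1) ∈ α.links),
    piHat q (2 * N) j (v (N + 1) α) = v N (α.remove j h)
  normalized : scalar (v 0 LinkPattern.empty) = 1

theorem IsPureSystem.mem_H1 {q : DefParam} {v : (N : ℕ) → LinkPattern N → TPow (2 * N)}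
    (hv : IsPureSystem q v) (N : ℕ) (α : LinkPattern N) : v N α ∈ H1 q (2 * N) :=
  ⟨hv.E_eq N α, hv.K_eq N α⟩

/-! ## Iterated projections -/

/-- Removability of the links `L 0, L 1, …, L (N-1)` in this order: each of them joins
consecutive indices once the previous ones are removed and the indices are relabeled. -/
def Removable : (N : ℕ) → (Fin N → ℕ × ℕ) → Prop
  | 0, _ => True
  | N + 1, L => (L 0).2 = (L 0).1 + 1 ∧ Removable N (fun i => relabelLink (L 0).1 (L i.succ))

/-- The composition `π̂_{a_N(N-1)} ∘ ⋯ ∘ π̂_{a_2(1)} ∘ π̂_{a_1}`, where `a_j(j-1)` is the left endpoint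
of the `j`-th link after removal of the first `j - 1` links. -/
def iterProj (q : DefParam) : (N : ℕ) → (Fin N → ℕ × ℕ) → TPow (2 * N) →ₗ[ℂ] ℂ
  | 0, _ => scalar.toLinearMap
  | N + 1, L => (iterProj q N (fun i => relabelLink (L 0).1 (L i.succ))) ∘ₗ
      (piHat q (2 * N) (L 0).1)

/-- An ordering of the links of `α ∈ LP_N`. -/
abbrev LinkPattern.Ordering {N : ℕ} (α : LinkPattern N) : Type := Fin N ≃ {l // l ∈ α.links}

/-- The ordering is allowable: all links of `α` can be removed in this order. -/
def LinkPattern.Allowable {N : ℕ} (α : LinkPattern N) (σ : α.Ordering) : Prop :=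
  Removable N (fun i => (σ i : ℕ × ℕ))

/-- The functional `ψ_α^{(σ)} : H₁(M₂^{⊗ 2N}) → ℂ`. -/
def psi (q : DefParam) {N : ℕ} (α : LinkPattern N) (σ : α.Ordering) :
    Module.Dual ℂ (H1 q (2 * N)) :=
  (iterProj q N (fun i => (σ i : ℕ × ℕ))) ∘ₗ (H1 q (2 * N)).subtype

end

end PureSLE

/-! The heart of the matter is a rigidity statement, `ProjFree.eq_zero`: in a positive tensor power,
a vector of the trivial subrepresentation killed by every singlet projection vanishes. Conceptually,
the common kernel of the `π̂_j` on `M₂^{⊗ n}` consists of the `q`-symmetric tensors, an irreducible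
representation of dimension `n + 1`, which has no invariant vectors for `n > 0`. Here this is a
computation in the coordinates of the rightmost tensorand, using that `q` is not a root of unity.

Since each `π̂_j` commutes with `E` and `K`, induction on `N` shows that a vector of `H1` is
determined by its iterated projections along link patterns (`eq_zero_of_isIterProj`). The order of
removal is irrelevant because projections at disjoint positions commute (`piHat_comm`,
`IsIterProj.unique`). This yields uniqueness of the `v_α` and `dim H1 ≤ |LP_N|`.

Two more inequalities close the circle `|LP_N| ≤ C_N ≤ dim H1 ≤ |LP_N|`: link patterns inject into
Dyck words, and rank-nullity bounds the kernel of `E` from weight 0 to weight 2 from below. Neither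
surjectivity onto Dyck words nor surjectivity of `E` has to be proved. The iterated projections
therefore form a basis of the dual space, and the `v_α` are the dual basis; their projection
equations are checked by applying iterated projections to both sides. -/

namespace PureSLE

noncomputable section

section

variable (q : DefParam)

/-! ## Coordinates with respect to the rightmost tensor component -/

/-- The coefficients of a vector of `M₂^{⊗ (n+1)}` with respect to the basis `e 0, e 1` of its
rightmost tensorand. -/
def components (n : ℕ) : TPow (n + 1) ≃ₗ[ℂ] (Fin 2 → TPow n) :=
  (snoc n).symm.trans (TensorProduct.piScalarRight ℂ ℂ (TPow n) (Fin 2))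

theorem components_snoc (n : ℕ) (x : TPow n) (y : M2) (i : Fin 2) :
    components n (snoc n (x ⊗ₜ y)) i = y i • x := by
  simp [components]

theorem ext_components {n : ℕ} {v w : TPow (n + 1)} (h0 : components n v 0 = components n w 0)
    (h1 : components n v 1 = components n w 1) : v = w := by
  apply (components n).injective
  ext i
  fin_cases i
  · exact h0
  · exact h1

/-- Zero is itself the image of a pure tensor, so pure tensors and sums suffice. -/
theorem snoc_induction {n : ℕ} {P : TPow (n + 1) → Prop}
    (tmul : ∀ x y, P (snoc n (x ⊗ₜ y))) (add : ∀ v w, P v → P w → P (v + w)) (v : TPow (n + 1)) :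
    P v := by
  obtain ⟨t, rfl⟩ := (snoc n).surjective v
  induction t using TensorProduct.induction_on with
  | zero => simpa using tmul 0 0
  | tmul x y => exact tmul x y
  | add a b ha hb => rw [map_add]; exact add _ _ ha hb

/-! ## The generators in coordinates -/

theorem repM2_E (x : M2) : repM2 q (gen q Gen.E) x = (x 1) • e 0 := by
  ext i
  fin_cases i <;> simp [repM2, matM2, e, Matrix.toLinAlgEquiv'_apply, Matrix.mulVec, dotProduct]

theorem repM2_K (x : M2) :
    repM2 q (gen q Gen.K) x = ((q : ℂ) * x 0) • e 0 + ((q : ℂ)⁻¹ * x 1) • e 1 := by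
  ext i
  fin_cases i <;> simp [repM2, matM2, e, Matrix.toLinAlgEquiv'_apply, Matrix.mulVec, dotProduct]

theorem rep_E_snoc (n : ℕ) (x : TPow n) (y : M2) :
    rep q (n + 1) (gen q Gen.E) (snoc n (x ⊗ₜ y)) =
      snoc n (rep q n (gen q Gen.E) x ⊗ₜ repM2 q (gen q Gen.K) y
        + x ⊗ₜ repM2 q (gen q Gen.E) y) := by
  simp [rep, tensorRep, comul, comulGen, Module.endTensorEndAlgHom_apply]

theorem rep_K_snoc (n : ℕ) (x : TPow n) (y : M2) :
    rep q (n + 1) (gen q Gen.K) (snoc n (x ⊗ₜ y)) =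
      snoc n (rep q n (gen q Gen.K) x ⊗ₜ repM2 q (gen q Gen.K) y) := by
  simp [rep, tensorRep, comul, comulGen, Module.endTensorEndAlgHom_apply]

@[simp]
theorem rep_zero_E (v : TPow 0) : rep q 0 (gen q Gen.E) v = 0 := by
  simp [rep, counit]

@[simp]
theorem rep_zero_K (v : TPow 0) : rep q 0 (gen q Gen.K) v = v := by
  simp [rep, counit]

theorem components_E_zero (n : ℕ) (v : TPow (n + 1)) :
    components n (rep q (n + 1) (gen q Gen.E) v) 0 =
      (q : ℂ) • rep q n (gen q Gen.E) (components n v 0) + components n v 1 := by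
  induction v using snoc_induction with
  | tmul x y =>
    simp [rep_E_snoc, components_snoc, repM2_E, repM2_K, e, mul_smul]
  | add v w hv hw => simp only [map_add, Pi.add_apply, smul_add, hv, hw]; abel

theorem components_E_one (n : ℕ) (v : TPow (n + 1)) :
    components n (rep q (n + 1) (gen q Gen.E) v) 1 =
      (q : ℂ)⁻¹ • rep q n (gen q Gen.E) (components n v 1) := by
  induction v using snoc_induction with
  | tmul x y =>
    simp [rep_E_snoc, components_snoc, repM2_E, repM2_K, e, mul_smul]
  | add v w hv hw => simp only [map_add, Pi.add_apply, smul_add, hv, hw]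

theorem components_K_zero (n : ℕ) (v : TPow (n + 1)) :
    components n (rep q (n + 1) (gen q Gen.K) v) 0 =
      (q : ℂ) • rep q n (gen q Gen.K) (components n v 0) := by
  induction v using snoc_induction with
  | tmul x y =>
    simp [rep_K_snoc, components_snoc, repM2_K, e, mul_smul]
  | add v w hv hw => simp only [map_add, Pi.add_apply, smul_add, hv, hw]

theorem components_K_one (n : ℕ) (v : TPow (n + 1)) :
    components n (rep q (n + 1) (gen q Gen.K) v) 1 =
      (q : ℂ)⁻¹ • rep q n (gen q Gen.K) (components n v 1) := by
  induction v using snoc_induction with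
  | tmul x y =>
    simp [rep_K_snoc, components_snoc, repM2_K, e, mul_smul]
  | add v w hv hw => simp only [map_add, Pi.add_apply, smul_add, hv, hw]

/-! ## The singlet projections in coordinates -/

/-- The normalization constant `(1 - q⁻²) / [2]` of the singlet projection. -/
def projCoeff : ℂ := (1 - ((q : ℂ) ^ 2)⁻¹) / qnum q 2

theorem projCoeff_ne_zero : projCoeff q ≠ 0 := by
  refine div_ne_zero ?_ (by rw [qnum_two]; exact qnum_two_ne_zero q)
  intro h
  apply q.2.2 2 two_pos
  rw [sub_eq_zero, eq_comm, inv_eq_one] at h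
  exact h

theorem singletProj_tmul (x y : M2) :
    singletProj q (x ⊗ₜ y) = projCoeff q * (x 1 * y 0 - (q : ℂ) * (x 0 * y 1)) := by
  have h := q.ne_zero
  have h2 : (q : ℂ)⁻¹ - q = -(q * (1 - ((q : ℂ) ^ 2)⁻¹)) := by field_simp; ring
  simp only [singletProj, projCoeff, TensorProduct.lift.tmul, LinearMap.mk₂_apply, h2]
  ring

/-- Together with `components_piHat` this turns `piHat` into a recursion in coordinates: position 1
is a `q`-antisymmetrization of the last two tensorands, and higher positions act on coefficients. -/
theorem piHat_one (n : ℕ) (v : TPow (n + 2)) :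
    piHat q n 1 v = projCoeff q • (components n (components (n + 1) v 0) 1
      - (q : ℂ) • components n (components (n + 1) v 1) 0) := by
  induction v using snoc_induction with
  | tmul x y =>
    induction x using snoc_induction with
    | tmul x z =>
      simp only [piHat, LinearMap.comp_apply, LinearEquiv.coe_coe, LinearEquiv.symm_apply_apply,
        LinearMap.rTensor_tmul, TensorProduct.assoc_tmul, LinearMap.lTensor_tmul,
        TensorProduct.rid_tmul, components_snoc, singletProj_tmul, map_smul, Pi.smul_apply,
        smul_smul, ← sub_smul]
      congr 2
      ring
    | add x x' hx hx' =>
      rw [TensorProduct.add_tmul, map_add, map_add, hx, hx']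
      simp only [map_add, Pi.add_apply, smul_add, smul_sub]
      abel
  | add v w hv hw =>
    simp only [map_add, Pi.add_apply, smul_add, hv, hw, smul_sub]
    abel

theorem components_piHat (n j : ℕ) (v : TPow (n + 3)) (i : Fin 2) :
    components n (piHat q (n + 1) (j + 2) v) i =
      piHat q n (j + 1) (components (n + 2) v i) := by
  induction v using snoc_induction with
  | tmul x y => simp [piHat, components_snoc]
  | add v w hv hw => simp only [map_add, Pi.add_apply, hv, hw]

/-- The projection `π̂` is a homomorphism to the trivial representation, so it commutes with the
action; hence projections preserve `H1`. -/
theorem piHat_E : ∀ (n j : ℕ) (v : TPow (n + 2)),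
    piHat q n j (rep q (n + 2) (gen q Gen.E) v) = rep q n (gen q Gen.E) (piHat q n j v)
  | n, 0, v => by simp [piHat]
  | n, 1, v => by
    have h := q.ne_zero
    rw [piHat_one, piHat_one]
    simp only [components_E_zero, components_E_one, map_add, map_smul, map_sub, Pi.add_apply,
      Pi.smul_apply, smul_add, smul_smul, mul_inv_cancel₀ h, inv_mul_cancel₀ h, one_smul]
    -- Both surplus terms are the coefficient of `e 1 ⊗ e 1`.
    rw [add_sub_add_right_eq_sub]
  | 0, _ + 2, v => by simp [piHat]
  | n + 1, j + 2, v => by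
    apply ext_components <;>
    simp only [components_piHat, components_E_zero, components_E_one, map_add, map_smul,
      piHat_E n (j + 1)]

theorem piHat_K : ∀ (n j : ℕ) (v : TPow (n + 2)),
    piHat q n j (rep q (n + 2) (gen q Gen.K) v) = rep q n (gen q Gen.K) (piHat q n j v)
  | n, 0, v => by simp [piHat]
  | n, 1, v => by
    have h := q.ne_zero
    rw [piHat_one, piHat_one]
    simp only [components_K_zero, components_K_one, map_smul, map_sub,
      Pi.smul_apply, smul_smul, mul_inv_cancel₀ h, inv_mul_cancel₀ h, one_smul]
  | 0, _ + 2, v => by simp [piHat]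
  | n + 1, j + 2, v => by
    apply ext_components <;>
    simp only [components_piHat, components_K_zero, components_K_one, map_smul,
      piHat_K n (j + 1)]

theorem piHat_mem_H1 {n : ℕ} (j : ℕ) {v : TPow (n + 2)} (hv : v ∈ H1 q (n + 2)) :
    piHat q n j v ∈ H1 q n :=
  ⟨by rw [← piHat_E, hv.1, map_zero], by rw [← piHat_K, hv.2]⟩

/-- Projections at disjoint positions commute, up to the shift of the positions. -/
theorem piHat_comm : ∀ (n j k : ℕ) (v : TPow (n + 4)), 1 ≤ j → j ≤ k →
    piHat q n k (piHat q (n + 2) j v) = piHat q n j (piHat q (n + 2) (k + 2) v)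
  | n, 1, k + 1, v, _, _ => by
    simp only [piHat_one, components_piHat, map_smul, map_sub]
  | 0, j + 2, k + 2, v, _, _ => by simp [piHat]
  | n + 1, j + 2, k + 2, v, _, hjk => by
    apply ext_components <;>
    rw [components_piHat, components_piHat, components_piHat, components_piHat,
      piHat_comm n (j + 1) (k + 1) _ (by omega) (by omega)]

/-! ## Vectors annihilated by all singlet projections -/

theorem smul_recursion_identity {V : Type*} [AddCommGroup V] [Module ℂ V] (c : ℂ) (n : ℕ)
    (x w : V) : c • c • (c ^ n • c • x - c • w) + (c ^ 2 - 1) • c • w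
      = c • (c ^ (n + 1) • c • x - w) := by
  module

theorem eq_zero_of_smul_eq_self {V : Type*} [AddCommGroup V] [Module ℂ V] {c : ℂ} (hc : c ≠ 1)
    {w : V} (h : c • w = w) : w = 0 := by
  have hz : (c - 1) • w = 0 := by rw [sub_smul, one_smul, h, sub_self]
  exact (smul_eq_zero.mp hz).resolve_left (sub_ne_zero.mpr hc)

/-- Multiplying `h1` by `c` and eliminating `c • x = -w` leaves the scalar `c² (c^(n+1) - 1) + (c² -
1) = c^(n+3) - 1` acting on `w`. -/
theorem smul_eq_self_of_relations {V : Type*} [AddCommGroup V] [Module ℂ V] {c : ℂ} {n : ℕ}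
    {x w : V} (h1 : (c ^ 2 - 1) • x = c • (c ^ n • c • w - w)) (h2 : 0 = c • x + w) :
    c ^ (n + 3) • w = w := by
  have h3 : c • c • (c ^ n • c • w - w) + (c ^ 2 - 1) • w = 0 := by
    rw [← h1, smul_comm, ← smul_add, ← h2, smul_zero]
  rw [← sub_eq_zero, ← h3]
  module

/-- The property of being annihilated by all singlet projections. -/
def ProjFree : (n : ℕ) → TPow n → Prop
  | 0, _ => True
  | 1, _ => True
  | n + 2, v => ∀ j, 1 ≤ j → j ≤ n + 1 → piHat q n j v = 0

variable {q}

theorem ProjFree.components : ∀ {n : ℕ} {v : TPow (n + 1)}, ProjFree q (n + 1) v → ∀ i,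
    ProjFree q n (components n v i)
  | 0, _, _, _ => trivial
  | 1, _, _, _ => trivial
  | n + 2, v, h, i => fun j h1 h2 => by
    obtain ⟨j, rfl⟩ : ∃ m, j = m + 1 := ⟨j - 1, by omega⟩
    rw [← components_piHat, h (j + 2) (by omega) (by omega), map_zero, Pi.zero_apply]

theorem ProjFree.components_comm {n : ℕ} {v : TPow (n + 2)} (h : ProjFree q (n + 2) v) :
    PureSLE.components n (PureSLE.components (n + 1) v 0) 1 =
      (q : ℂ) • PureSLE.components n (PureSLE.components (n + 1) v 1) 0 := by
  have h1 := h 1 le_rfl (by omega)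
  rw [piHat_one, smul_eq_zero] at h1
  exact sub_eq_zero.mp (h1.resolve_left (projCoeff_ne_zero q))

/-- For a `q`-symmetric tensor the two coefficients are linked: on each weight space `E v₀` is a
multiple of `v₁`. Writing the weight-dependent factor through `K` removes any weight assumption on
`v`, so that the induction applies to both coefficients; `components_comm` reconciles the mixed
terms. -/
theorem ProjFree.rep_E : ∀ {n : ℕ} {v : TPow (n + 1)}, ProjFree q (n + 1) v →
    ((q : ℂ) ^ 2 - 1) • rep q n (gen q Gen.E) (PureSLE.components n v 0) =
      (q : ℂ) • ((q : ℂ) ^ n • rep q n (gen q Gen.K) (PureSLE.components n v 1)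
        - PureSLE.components n v 1)
  | 0, v, _ => by simp
  | n + 1, v, h => by
    have hq := q.ne_zero
    have h0 := (h.components 0).rep_E
    have h1 := (h.components 1).rep_E
    have hc := h.components_comm
    rw [hc] at h0
    apply ext_components
    · simp only [map_smul, map_sub, Pi.smul_apply, Pi.sub_apply, components_E_zero,
        components_K_zero]
      rw [hc, smul_add, smul_comm, h0, map_smul]
      exact smul_recursion_identity _ _ _ _
    · simp only [map_smul, map_sub, Pi.smul_apply, Pi.sub_apply, components_E_one,
        components_K_one]
      rw [hc, map_smul, smul_smul (q : ℂ)⁻¹, inv_mul_cancel₀ hq, one_smul, h1, pow_succ, mul_smul,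
        smul_smul (q : ℂ) (q : ℂ)⁻¹, mul_inv_cancel₀ hq, one_smul]

/-- By `q`-symmetry, if `e 1` is absent from the last tensorand it is absent from the one before,
and so on: `v` is a multiple of `e 0 ⊗ ⋯ ⊗ e 0`. -/
theorem ProjFree.rep_K : ∀ {n : ℕ} {v : TPow (n + 1)}, ProjFree q (n + 1) v →
    PureSLE.components n v 1 = 0 → rep q (n + 1) (gen q Gen.K) v = (q : ℂ) ^ (n + 1) • v
  | 0, v, _, h1 => by
    apply ext_components
    · simp [components_K_zero]
    · simp [components_K_one, h1]
  | n + 1, v, h, h1 => by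
    have hc := h.components_comm
    rw [h1, map_zero, Pi.zero_apply, smul_zero] at hc
    apply ext_components
    · rw [components_K_zero, (h.components 0).rep_K hc, map_smul, Pi.smul_apply, smul_smul]
      ring_nf
    · simp [components_K_one, h1]

/-- A vector of the trivial subrepresentation that is annihilated by all singlet projections
vanishes. -/
theorem ProjFree.eq_zero {n : ℕ} {v : TPow (n + 1)} (h : ProjFree q (n + 1) v)
    (hv : v ∈ H1 q (n + 1)) : v = 0 := by
  have hq := q.ne_zero
  have hE := components_E_zero q n v
  have hK := components_K_one q n v
  rw [hv.1, map_zero, Pi.zero_apply] at hE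
  rw [hv.2] at hK
  have hK' : rep q n (gen q Gen.K) (PureSLE.components n v 1)
      = (q : ℂ) • PureSLE.components n v 1 := by
    nth_rewrite 2 [hK]
    rw [smul_smul, mul_inv_cancel₀ hq, one_smul]
  have hE' := h.rep_E
  rw [hK'] at hE'
  -- With `K v₁ = q v₁` and `q E v₀ = -v₁`, the recursion gives `q^(n+3) v₁ = v₁`.
  have h1 : PureSLE.components n v 1 = 0 :=
    eq_zero_of_smul_eq_self (q.2.2 (n + 3) (by omega)) (smul_eq_self_of_relations hE' hE)
  -- The remaining vector has weight `q^(n+1) ≠ 1`, against `K v = v`.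
  have hK2 := h.rep_K h1
  rw [hv.2] at hK2
  exact eq_zero_of_smul_eq_self (q.2.2 _ (by omega)) hK2.symm

end

section

/-! ## Removing and inserting links -/

/-- The inverse of the relabeling: indices from `j` on are raised by two. -/
def unrelabel (j i : ℕ) : ℕ := if i < j then i else i + 2

/-- The inverse relabeling of both endpoints of a link. -/
def unrelabelLink (j : ℕ) (l : ℕ × ℕ) : ℕ × ℕ := (unrelabel j l.1, unrelabel j l.2)

theorem relabel_unrelabel (j i : ℕ) : relabel j (unrelabel j i) = i := by
  unfold relabel unrelabel; split_ifs <;> omega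

theorem unrelabel_relabel {j i : ℕ} (h : i ≠ j) (h' : i ≠ j + 1) :
    unrelabel j (relabel j i) = i := by
  unfold relabel unrelabel; split_ifs <;> omega

theorem unrelabel_ne (j i : ℕ) : unrelabel j i ≠ j ∧ unrelabel j i ≠ j + 1 := by
  unfold unrelabel; split_ifs <;> omega

theorem unrelabel_strictMono (j : ℕ) : StrictMono (unrelabel j) := by
  intro x y h
  unfold unrelabel; split_ifs <;> omega

theorem relabelLink_unrelabelLink (j : ℕ) (l : ℕ × ℕ) :
    relabelLink j (unrelabelLink j l) = l := by
  simp [relabelLink, unrelabelLink, relabel_unrelabel]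

theorem unrelabelLink_injective (j : ℕ) : Function.Injective (unrelabelLink j) :=
  Function.LeftInverse.injective (relabelLink_unrelabelLink j)

theorem unrelabelLink_ne (j : ℕ) (l : ℕ × ℕ) : unrelabelLink j l ≠ (j, j + 1) :=
  fun h => (unrelabel_ne j l.1).1 (congrArg Prod.fst h)

theorem unrelabel_comm {j k : ℕ} (hjk : j ≤ k) (i : ℕ) :
    unrelabel j (unrelabel k i) = unrelabel (k + 2) (unrelabel j i) := by
  unfold unrelabel; split_ifs <;> omega

theorem sign_unrelabel (j x y : ℕ) :
    SignType.sign ((unrelabel j x : ℤ) - unrelabel j y) = SignType.sign ((x : ℤ) - y) := by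
  rcases lt_trichotomy x y with h | h | h
  · have := unrelabel_strictMono j h
    rw [sign_neg (a := (x : ℤ) - y) (by omega), sign_neg (by omega)]
  · subst h; simp
  · have := unrelabel_strictMono j h
    rw [sign_pos (a := (x : ℤ) - y) (by omega), sign_pos (by omega)]

namespace LinkPattern

instance : Subsingleton (LinkPattern 0) := by
  have key : ∀ α : LinkPattern 0, α.links = ∅ := fun α =>
    Finset.eq_empty_of_forall_notMem fun l hl => by
      have := α.range l hl
      omega
  exact ⟨fun α β => LinkPattern.ext (by rw [key, key])⟩

variable {N : ℕ}

theorem eq_of_shared_endpoint (α : LinkPattern N) {l m : ℕ × ℕ} (hl : l ∈ α.links)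
    (hm : m ∈ α.links) (i : ℕ) (hli : l.1 = i ∨ l.2 = i) (hmi : m.1 = i ∨ m.2 = i) : l = m := by
  have h1 := α.range l hl
  exact (α.partition i (by omega) (by omega)).unique ⟨hl, hli⟩ ⟨hm, hmi⟩

/-- Two links do not cross. -/
theorem not_crossing (α : LinkPattern N) {a b c d : ℕ} (h : (a, b) ∈ α.links)
    (h' : (c, d) ∈ α.links) (h1 : a < c) (h2 : c < b) (h3 : b < d) : False := by
  have hp := α.planar _ h _ h' (by rintro ⟨⟩; omega)
  simp only at hp
  have e1 : (0 : ℤ) < c - a := by omega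
  have e2 : (0 : ℤ) < d - b := by omega
  have e3 : (0 : ℤ) < b - c := by omega
  have e4 : (0 : ℤ) < d - a := by omega
  have := mul_pos (mul_pos (mul_pos e1 e2) e3) e4
  linarith

theorem unrelabelLink_relabelLink_of_mem (α : LinkPattern N) {j : ℕ}
    (h : (j, j + 1) ∈ α.links) {l : ℕ × ℕ} (hl : l ∈ α.links) (hne : l ≠ (j, j + 1)) :
    unrelabelLink j (relabelLink j l) = l := by
  have := α.endpoint_ne h hl hne
  simp [relabelLink, unrelabelLink, unrelabel_relabel this.1.1 this.1.2,
    unrelabel_relabel this.2.1 this.2.2]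

/-- Unlike `relabelLink`, the map `unrelabelLink` is injective on all pairs, so describing removal
as a preimage carries no side conditions. -/
theorem mem_remove (α : LinkPattern (N + 1)) {j : ℕ} (h : (j, j + 1) ∈ α.links) (l : ℕ × ℕ) :
    l ∈ (α.remove j h).links ↔ unrelabelLink j l ∈ α.links := by
  simp only [remove, Finset.mem_image, Finset.mem_erase]
  constructor
  · rintro ⟨m, ⟨hne, hm⟩, rfl⟩
    rwa [α.unrelabelLink_relabelLink_of_mem h hm hne]
  · intro hl
    exact ⟨_, ⟨unrelabelLink_ne j l, hl⟩, relabelLink_unrelabelLink j l⟩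

theorem mem_iff_of_remove (α : LinkPattern (N + 1)) {j : ℕ} (h : (j, j + 1) ∈ α.links)
    (l : ℕ × ℕ) :
    l ∈ α.links ↔ l = (j, j + 1) ∨ ∃ m ∈ (α.remove j h).links, unrelabelLink j m = l := by
  constructor
  · intro hl
    by_cases hne : l = (j, j + 1)
    · exact Or.inl hne
    · have := α.unrelabelLink_relabelLink_of_mem h hl hne
      exact Or.inr ⟨relabelLink j l, by rwa [mem_remove, this], this⟩
  · rintro (rfl | ⟨m, hm, rfl⟩)
    · exact h
    · rwa [← mem_remove]

theorem remove_injective {α β : LinkPattern (N + 1)} {j : ℕ} (hα : (j, j + 1) ∈ α.links)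
    (hβ : (j, j + 1) ∈ β.links) (h : α.remove j hα = β.remove j hβ) : α = β := by
  ext1
  ext1 l
  rw [mem_iff_of_remove α hα, mem_iff_of_remove β hβ, h]

theorem mem_remove_left (α : LinkPattern (N + 1)) {j k : ℕ} (hjk : j ≤ k)
    (hj : (j, j + 1) ∈ α.links) (hk : (k + 2, k + 3) ∈ α.links) :
    (k, k + 1) ∈ (α.remove j hj).links := by
  rw [mem_remove, unrelabelLink, unrelabel, unrelabel, if_neg (by omega), if_neg (by omega)]
  exact hk

theorem mem_remove_right (α : LinkPattern (N + 1)) {j k : ℕ} (hjk : j ≤ k)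
    (hj : (j, j + 1) ∈ α.links) (hk : (k + 2, k + 3) ∈ α.links) :
    (j, j + 1) ∈ (α.remove (k + 2) hk).links := by
  rw [mem_remove, unrelabelLink, unrelabel, unrelabel, if_pos (by omega), if_pos (by omega)]
  exact hj

theorem remove_comm (α : LinkPattern (N + 2)) {j k : ℕ} (hjk : j ≤ k)
    (hj : (j, j + 1) ∈ α.links) (hk : (k + 2, k + 3) ∈ α.links) :
    (α.remove j hj).remove k (α.mem_remove_left hjk hj hk) =
      (α.remove (k + 2) hk).remove j (α.mem_remove_right hjk hj hk) := by
  ext1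
  ext1 l
  simp only [mem_remove, unrelabelLink, unrelabel_comm hjk]

/-- A shortest link `(a, b)` works: if `a + 1 < b`, the link at `a + 1` would be shorter or cross
`(a, b)`. -/
theorem exists_innermost (α : LinkPattern (N + 1)) : ∃ j, (j, j + 1) ∈ α.links := by
  obtain ⟨l, ⟨hl, -⟩, -⟩ := α.partition 1 le_rfl (by omega)
  obtain ⟨⟨a, b⟩, hm, hmin⟩ := α.links.exists_min_image (fun l => l.2 - l.1) ⟨l, hl⟩
  have hr := α.range _ hm
  simp only at hr
  rcases (show b = a + 1 ∨ a + 1 < b by omega) with rfl | hab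
  · exact ⟨a, hm⟩
  exfalso
  obtain ⟨⟨c, d⟩, ⟨hcd, hi⟩, -⟩ := α.partition (a + 1) (by omega) (by omega)
  have hr' := α.range _ hcd
  have hmin' := hmin _ hcd
  simp only at hr' hmin' hi
  rcases hi with rfl | rfl
  · have : ¬ b < d := α.not_crossing hm hcd (by omega) hab
    omega
  · have hca : c ≠ a := by
      rintro rfl
      have := α.eq_of_shared_endpoint hm hcd c (Or.inl rfl) (Or.inl rfl)
      simp only [Prod.mk.injEq] at this
      omega
    exact α.not_crossing hcd hm (by omega) (by omega) hab

/-- The link pattern obtained from `β` by inserting the link `(j, j+1)`. -/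
def insertLink (β : LinkPattern N) (j : ℕ) (h1 : 1 ≤ j) (h2 : j ≤ 2 * N + 1) :
    LinkPattern (N + 1) where
  links := insert (j, j + 1) (β.links.image (unrelabelLink j))
  range := by
    intro l hl
    simp only [Finset.mem_insert, Finset.mem_image] at hl
    rcases hl with rfl | ⟨m, hm, rfl⟩
    · simp only; omega
    · have := β.range m hm
      simp only [unrelabelLink, unrelabel]
      split_ifs <;> omega
  partition := by
    intro i hi1 hi2
    by_cases hij : i = j ∨ i = j + 1
    · refine ⟨(j, j + 1), ⟨Finset.mem_insert_self _ _, ?_⟩, ?_⟩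
      · simp only; omega
      · rintro l ⟨hl, hli⟩
        simp only [Finset.mem_insert, Finset.mem_image] at hl
        rcases hl with rfl | ⟨m, hm, rfl⟩
        · rfl
        · have e1 := unrelabel_ne j m.1
          have e2 := unrelabel_ne j m.2
          simp only [unrelabelLink] at hli
          omega
    · have hinv : unrelabel j (relabel j i) = i :=
        unrelabel_relabel (by omega) (by omega)
      have hr : 1 ≤ relabel j i ∧ relabel j i ≤ 2 * N := by
        unfold relabel; split_ifs <;> omega
      obtain ⟨m, ⟨hm, hmi⟩, huniq⟩ := β.partition (relabel j i) hr.1 hr.2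
      refine ⟨unrelabelLink j m,
        ⟨Finset.mem_insert_of_mem (Finset.mem_image_of_mem _ hm), ?_⟩, ?_⟩
      · rcases hmi with h | h
        · left; simp only [unrelabelLink, h, hinv]
        · right; simp only [unrelabelLink, h, hinv]
      · rintro l ⟨hl, hli⟩
        simp only [Finset.mem_insert, Finset.mem_image] at hl
        rcases hl with rfl | ⟨m', hm', rfl⟩
        · simp only at hli; omega
        · rw [huniq m' ⟨hm', ?_⟩]
          rcases hli with h | h
          · left; rw [← h]; simp [unrelabelLink, relabel_unrelabel]
          · right; rw [← h]; simp [unrelabelLink, relabel_unrelabel]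
  planar := by
    -- A raised index lies on the same side of `j` and `j + 1`; the planarity product of the new
    -- link with an old one regroups into two such factors.
    have key : ∀ x : ℕ, (0 : ℤ) < ((j : ℤ) - unrelabel j x) * ((j + 1 : ℕ) - unrelabel j x) := by
      intro x
      have := unrelabel_ne j x
      rcases lt_or_gt_of_ne this.1 with h | h
      · exact mul_pos (by omega) (by omega)
      · exact mul_pos_of_neg_of_neg (by omega) (by omega)
    intro l hl m hm hlm
    simp only [Finset.mem_insert, Finset.mem_image] at hl hm
    rcases hl with rfl | ⟨l, hl, rfl⟩ <;> rcases hm with rfl | ⟨m, hm, rfl⟩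
    · exact absurd rfl hlm
    · have := mul_pos (key m.1) (key m.2)
      simp only [unrelabelLink]
      linarith
    · have := mul_pos (key l.1) (key l.2)
      simp only [unrelabelLink]
      linarith
    · have hp := β.planar l hl m hm (by rintro rfl; exact hlm rfl)
      rw [← sign_eq_one_iff] at hp ⊢
      simpa only [sign_mul, unrelabelLink, sign_unrelabel] using hp

theorem mem_insertLink (β : LinkPattern N) (j : ℕ) (h1 : 1 ≤ j) (h2 : j ≤ 2 * N + 1) :
    (j, j + 1) ∈ (β.insertLink j h1 h2).links :=
  Finset.mem_insert_self _ _

theorem remove_insertLink (β : LinkPattern N) (j : ℕ) (h1 : 1 ≤ j) (h2 : j ≤ 2 * N + 1) :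
    (β.insertLink j h1 h2).remove j (β.mem_insertLink j h1 h2) = β := by
  ext1
  ext1 l
  rw [mem_remove]
  simp only [insertLink, Finset.mem_insert, unrelabelLink_ne, false_or]
  exact (unrelabelLink_injective j).mem_finset_image

/-! ## Counting link patterns -/

/-- The left endpoints of the links. -/
def leftEnds (α : LinkPattern N) : Finset ℕ := α.links.image Prod.fst

theorem mem_leftEnds (α : LinkPattern N) (i : ℕ) : i ∈ α.leftEnds ↔ ∃ b, (i, b) ∈ α.links := by
  simp [leftEnds]

theorem mem_leftEnds_remove (α : LinkPattern (N + 1)) {j : ℕ} (h : (j, j + 1) ∈ α.links) (i : ℕ) :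
    i ∈ (α.remove j h).leftEnds ↔ unrelabel j i ∈ α.leftEnds := by
  simp only [mem_leftEnds, mem_remove, unrelabelLink]
  refine ⟨fun ⟨b, hb⟩ => ⟨_, hb⟩, fun ⟨b, hb⟩ => ⟨relabel j b, ?_⟩⟩
  have hne : (unrelabel j i, b) ≠ (j, j + 1) := fun h' =>
    (unrelabel_ne j i).1 (congrArg Prod.fst h')
  have := α.endpoint_ne h hb hne
  rwa [unrelabel_relabel this.2.1 this.2.2]

theorem notMem_leftEnds_iff (α : LinkPattern N) {i : ℕ} (h1 : 1 ≤ i) (h2 : i ≤ 2 * N) :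
    i ∉ α.leftEnds ↔ ∃ a, (a, i) ∈ α.links := by
  rw [mem_leftEnds]
  constructor
  · intro h
    obtain ⟨⟨a, b⟩, ⟨hl, hi⟩, -⟩ := α.partition i h1 h2
    rcases hi with rfl | rfl
    · exact absurd ⟨b, hl⟩ h
    · exact ⟨a, hl⟩
  · rintro ⟨a, ha⟩ ⟨b, hb⟩
    have := α.eq_of_shared_endpoint ha hb i (Or.inr rfl) (Or.inl rfl)
    have hr := α.range _ ha
    simp only [Prod.mk.injEq] at this hr
    omega

/-- If an opening at `j` and a closing at `j + 1` belonged to different links, these would cross. -/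
theorem mem_links_of_leftEnds (α : LinkPattern N) {j : ℕ} (h : j + 1 ≤ 2 * N)
    (hj : j ∈ α.leftEnds) (hj' : j + 1 ∉ α.leftEnds) : (j, j + 1) ∈ α.links := by
  rw [α.notMem_leftEnds_iff (by omega) h] at hj'
  obtain ⟨a, ha⟩ := hj'
  obtain ⟨b, hb⟩ := (α.mem_leftEnds j).mp hj
  have hr := α.range _ ha
  have hr' := α.range _ hb
  simp only at hr hr'
  rcases lt_trichotomy a j with h1 | rfl | h1
  · rcases lt_trichotomy b (j + 1) with h2 | rfl | h2
    · omega
    · exact hb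
    · exact (α.not_crossing ha hb h1 (by omega) h2).elim
  · exact ha
  · omega

/-- An innermost link is visible in the left endpoints alone, hence shared by both patterns; remove
it and induct. -/
theorem leftEnds_injective : ∀ {N : ℕ}, Function.Injective (leftEnds (N := N))
  | 0, _, _, _ => Subsingleton.elim _ _
  | N + 1, α, β, h => by
    obtain ⟨j, hj⟩ := α.exists_innermost
    have hr := α.range _ hj
    simp only at hr
    have hj' : (j, j + 1) ∈ β.links := by
      apply β.mem_links_of_leftEnds hr.2.2
      · rw [← h, mem_leftEnds]; exact ⟨_, hj⟩
      · rw [← h, α.notMem_leftEnds_iff (by omega) hr.2.2]; exact ⟨_, hj⟩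
    apply remove_injective hj hj'
    apply leftEnds_injective
    ext i
    rw [mem_leftEnds_remove, mem_leftEnds_remove, h]

/-- The list of up and down steps of a link pattern: up at the left endpoints, down at the right
endpoints, among the first `k` indices. -/
def steps (α : LinkPattern N) (k : ℕ) : List DyckStep :=
  (List.range k).map fun i => if i + 1 ∈ α.leftEnds then DyckStep.U else DyckStep.D

theorem length_steps (α : LinkPattern N) (k : ℕ) : (α.steps k).length = k := by simp [steps]

theorem steps_succ (α : LinkPattern N) (k : ℕ) :
    α.steps (k + 1) = α.steps k ++ [if k + 1 ∈ α.leftEnds then DyckStep.U else DyckStep.D] := by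
  simp [steps, List.range_succ]

theorem take_steps (α : LinkPattern N) (i k : ℕ) : (α.steps k).take i = α.steps (min i k) := by
  simp [steps, ← List.map_take, List.take_range]

theorem filter_le_succ (s : Finset (ℕ × ℕ)) (f : ℕ × ℕ → ℕ) (k : ℕ) :
    (s.filter fun l => f l ≤ k + 1).card =
      (s.filter fun l => f l ≤ k).card + (s.filter fun l => f l = k + 1).card := by
  rw [← Finset.card_union_of_disjoint]
  · congr 1
    ext l
    simp only [Finset.mem_filter, Finset.mem_union, ← and_or_left]
    refine and_congr_right fun _ => ?_
    omega
  · rw [Finset.disjoint_filter]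
    intro l _ h
    omega

/-- Each index lies on only one link, so it contributes at most one. The free `p` lets left and
right endpoints both be decided by membership in `leftEnds`. -/
theorem card_filter_endpoint (α : LinkPattern N) (f : ℕ × ℕ → ℕ)
    (hf : ∀ l, l.1 = f l ∨ l.2 = f l) (k : ℕ) (p : Prop) [Decidable p]
    (hp : p ↔ ∃ l ∈ α.links, f l = k) :
    (α.links.filter fun l => f l = k).card = if p then 1 else 0 := by
  split_ifs with h
  · obtain ⟨l, hl, hk⟩ := hp.mp h
    rw [Finset.card_eq_one]
    refine ⟨l, ?_⟩
    ext m
    simp only [Finset.mem_filter, Finset.mem_singleton]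
    constructor
    · rintro ⟨hm, hmk⟩
      exact α.eq_of_shared_endpoint hm hl k (hmk ▸ hf m) (hk ▸ hf l)
    · rintro rfl
      exact ⟨hl, hk⟩
  · rw [Finset.card_eq_zero, Finset.filter_eq_empty_iff]
    exact fun l hl hk => h (hp.mpr ⟨l, hl, hk⟩)

theorem count_steps (α : LinkPattern N) : ∀ k, k ≤ 2 * N →
    (α.steps k).count DyckStep.U = (α.links.filter fun l => l.1 ≤ k).card ∧
    (α.steps k).count DyckStep.D = (α.links.filter fun l => l.2 ≤ k).card
  | 0, _ => by
    have h : ∀ l ∈ α.links, ¬ l.1 ≤ 0 ∧ ¬ l.2 ≤ 0 := fun l hl => by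
      have := α.range l hl
      omega
    simp only [steps, List.range_zero, List.map_nil, List.count_nil]
    rw [Finset.filter_false_of_mem fun l hl => (h l hl).1,
      Finset.filter_false_of_mem fun l hl => (h l hl).2]
    simp
  | k + 1, hk => by
    have ih := α.count_steps k (by omega)
    have hU := α.card_filter_endpoint Prod.fst (fun _ => Or.inl rfl) (k + 1) (k + 1 ∈ α.leftEnds)
      (by simp [mem_leftEnds])
    have hD := α.card_filter_endpoint Prod.snd (fun _ => Or.inr rfl) (k + 1) (k + 1 ∉ α.leftEnds)
      (by rw [α.notMem_leftEnds_iff (by omega) hk]; simp)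
    rw [steps_succ, List.count_append, List.count_append, ih.1, ih.2, filter_le_succ,
      filter_le_succ, hU, hD]
    by_cases h : k + 1 ∈ α.leftEnds <;> simp [h]

/-- The Dyck word of a link pattern. -/
def toDyckWord (α : LinkPattern N) : DyckWord where
  toList := α.steps (2 * N)
  count_U_eq_count_D := by
    rw [(α.count_steps _ le_rfl).1, (α.count_steps _ le_rfl).2]
    congr 1
    ext l
    simp only [Finset.mem_filter]
    refine and_congr_right fun hl => ?_
    have := α.range l hl
    omega
  count_D_le_count_U i := by
    rw [take_steps, (α.count_steps _ (min_le_right _ _)).1, (α.count_steps _ (min_le_right _ _)).2]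
    -- A link closed within the prefix was also opened there.
    refine Finset.card_le_card fun l hl => ?_
    simp only [Finset.mem_filter] at hl ⊢
    have := α.range l hl.1
    exact ⟨hl.1, by omega⟩

theorem semilength_toDyckWord (α : LinkPattern N) : α.toDyckWord.semilength = N := by
  have h := α.toDyckWord.two_mul_semilength_eq_length
  rw [show α.toDyckWord.toList = α.steps (2 * N) from rfl, length_steps] at h
  omega

theorem toDyckWord_injective : Function.Injective (toDyckWord (N := N)) := by
  intro α β h
  have hs : α.steps (2 * N) = β.steps (2 * N) := congrArg DyckWord.toList h
  have hr : ∀ (γ : LinkPattern N), ∀ i ∈ γ.leftEnds, 1 ≤ i ∧ i ≤ 2 * N := fun γ i hi => by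
    obtain ⟨b, hb⟩ := (γ.mem_leftEnds i).mp hi
    have := γ.range _ hb
    simp only at this
    omega
  have hk : ∀ i, 1 ≤ i ∧ i ≤ 2 * N → (i ∈ α.leftEnds ↔ i ∈ β.leftEnds) := by
    rintro i ⟨h1, h2⟩
    obtain ⟨i, rfl⟩ : ∃ k, i = k + 1 := ⟨i - 1, by omega⟩
    rw [steps, steps, List.map_inj_left] at hs
    have := hs i (by simp; omega)
    by_cases ha : i + 1 ∈ α.leftEnds <;> by_cases hb : i + 1 ∈ β.leftEnds <;> simp_all
  apply leftEnds_injective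
  ext i
  exact ⟨fun hi => (hk i (hr α i hi)).mp hi, fun hi => (hk i (hr β i hi)).mpr hi⟩

/-- Link patterns as Dyck words of the appropriate length. -/
def toDyckWordOfSemilength (α : LinkPattern N) : {p : DyckWord // p.semilength = N} :=
  ⟨α.toDyckWord, α.semilength_toDyckWord⟩

theorem toDyckWordOfSemilength_injective :
    Function.Injective (toDyckWordOfSemilength (N := N)) :=
  fun _ _ h => toDyckWord_injective (congrArg Subtype.val h)

instance : Fintype (LinkPattern N) :=
  Fintype.ofInjective _ toDyckWordOfSemilength_injective

theorem card_le_catalan (N : ℕ) : Fintype.card (LinkPattern N) ≤ catalan N := by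
  rw [← DyckWord.card_dyckWord_semilength_eq_catalan]
  exact Fintype.card_le_of_injective _ toDyckWordOfSemilength_injective

end LinkPattern

end

section

variable (q : DefParam)

/-! ## Iterated projections along link patterns -/

/-- The functional `f` is a composition of projections that removes the links of `α` one after
another. -/
def IsIterProj : (N : ℕ) → LinkPattern N → (TPow (2 * N) →ₗ[ℂ] ℂ) → Prop
  | 0, _, f => f = scalar.toLinearMap
  | N + 1, α, f => ∃ (j : ℕ) (h : (j, j + 1) ∈ α.links) (g : TPow (2 * N) →ₗ[ℂ] ℂ),
      IsIterProj N (α.remove j h) g ∧ f = g ∘ₗ piHat q (2 * N) j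

variable {q}

theorem exists_isIterProj (q : DefParam) : ∀ {N : ℕ} (α : LinkPattern N), ∃ f, IsIterProj q N α f
  | 0, _ => ⟨_, rfl⟩
  | N + 1, α => by
    obtain ⟨j, hj⟩ := α.exists_innermost
    obtain ⟨g, hg⟩ := exists_isIterProj q (α.remove j hj)
    exact ⟨_, j, hj, g, hg, rfl⟩

/-- The diamond step: for different first links, continue each removal by the other link. Both
routes reach the same pattern, and `piHat_comm` identifies the two double projections. -/
theorem comp_piHat_eq_of_isIterProj {N : ℕ} (ih : ∀ (α : LinkPattern N) (f f' : _),
    IsIterProj q N α f → IsIterProj q N α f' → f = f') {α : LinkPattern (N + 1)} {j k : ℕ}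
    (hj : (j, j + 1) ∈ α.links) (hk : (k, k + 1) ∈ α.links) {g g' : TPow (2 * N) →ₗ[ℂ] ℂ}
    (hg : IsIterProj q N (α.remove j hj) g) (hg' : IsIterProj q N (α.remove k hk) g')
    (hjk : j ≤ k) : g ∘ₗ piHat q (2 * N) j = g' ∘ₗ piHat q (2 * N) k := by
  rcases hjk.eq_or_lt with rfl | hlt
  · rw [ih _ _ _ hg hg']
  have hne : (k, k + 1) ≠ (j, j + 1) := by
    intro h
    simp only [Prod.mk.injEq] at h
    omega
  have hd := α.endpoint_ne hj hk hne
  simp only at hd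
  -- Distinct links share no endpoint, so `j < k` forces `j + 2 ≤ k`.
  obtain ⟨k, rfl⟩ : ∃ m, k = m + 2 := ⟨k - 2, by omega⟩
  have hjk' : j ≤ k := by omega
  have hr := α.range _ hj
  obtain _ | N := N
  · have hr' := α.range _ hk
    simp only at hr hr'
    omega
  obtain ⟨h, hh⟩ := exists_isIterProj q ((α.remove j hj).remove k (α.mem_remove_left hjk' hj hk))
  have e1 : g = h ∘ₗ piHat q (2 * N) k := ih _ _ _ hg ⟨k, _, h, hh, rfl⟩
  rw [α.remove_comm hjk' hj hk] at hh
  have e2 : g' = h ∘ₗ piHat q (2 * N) j := ih _ _ _ hg' ⟨j, _, h, hh, rfl⟩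
  rw [e1, e2]
  refine LinearMap.ext fun v => ?_
  exact congrArg h (piHat_comm q (2 * N) j k v hr.1 hjk')

/-- The composition of projections does not depend on the order of removal of the links. -/
theorem IsIterProj.unique : ∀ {N : ℕ} (α : LinkPattern N) (f f' : TPow (2 * N) →ₗ[ℂ] ℂ),
    IsIterProj q N α f → IsIterProj q N α f' → f = f'
  | 0, _, _, _, h, h' => h.trans h'.symm
  | N + 1, α, f, f', ⟨j, hj, g, hg, hf⟩, ⟨k, hk, g', hg', hf'⟩ => by
    rw [hf, hf']
    rcases le_total j k with h | h
    · exact comp_piHat_eq_of_isIterProj IsIterProj.unique hj hk hg hg' h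
    · exact (comp_piHat_eq_of_isIterProj IsIterProj.unique hk hj hg' hg h).symm

/-- Passes from orderings to the order-free relation `IsIterProj`. Enumerating the links without
repetition survives a removal, since relabeling is invertible on the remaining links. -/
theorem isIterProj_iterProj : ∀ {N : ℕ} (α : LinkPattern N) (L : Fin N → ℕ × ℕ),
    Function.Injective L → (∀ l, l ∈ α.links ↔ ∃ i, L i = l) → Removable N L →
    IsIterProj q N α (iterProj q N L)
  | 0, _, _, _, _, _ => rfl
  | N + 1, α, L, hinj, hmem, ⟨h0, hrem⟩ => by
    have hL0 : L 0 = ((L 0).1, (L 0).1 + 1) := Prod.ext rfl h0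
    have hj : ((L 0).1, (L 0).1 + 1) ∈ α.links := by
      rw [← hL0]
      exact (hmem _).mpr ⟨0, rfl⟩
    have hL : ∀ i : Fin N, unrelabelLink (L 0).1 (relabelLink (L 0).1 (L i.succ)) = L i.succ := by
      intro i
      apply α.unrelabelLink_relabelLink_of_mem hj ((hmem _).mpr ⟨_, rfl⟩)
      rw [← hL0]
      exact fun h => Fin.succ_ne_zero i (hinj h)
    refine ⟨(L 0).1, hj, _, isIterProj_iterProj _ _ ?_ ?_ hrem, rfl⟩
    · intro i i' h
      have := congrArg (unrelabelLink (L 0).1) h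
      simp only [hL] at this
      exact Fin.succ_injective _ (hinj this)
    · intro l
      rw [LinkPattern.mem_remove, hmem, Fin.exists_fin_succ]
      rw [hL0]
      simp only [(unrelabelLink_ne _ _).symm, false_or]
      refine exists_congr fun i => ?_
      constructor
      · intro h
        rw [h, relabelLink_unrelabelLink]
      · rintro rfl
        exact (hL i).symm

theorem exists_removable : ∀ {N : ℕ} (α : LinkPattern N), ∃ L : Fin N → ℕ × ℕ,
    Function.Injective L ∧ (∀ l, l ∈ α.links ↔ ∃ i, L i = l) ∧ Removable N L
  | 0, α => by
    refine ⟨Fin.elim0, fun i => i.elim0, fun l => ?_, trivial⟩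
    simp only [IsEmpty.exists_iff, iff_false]
    intro hl
    have := α.range l hl
    omega
  | N + 1, α => by
    obtain ⟨j, hj⟩ := α.exists_innermost
    obtain ⟨L, hinj, hmem, hrem⟩ := exists_removable (α.remove j hj)
    refine ⟨Fin.cons (j, j + 1) (fun i => unrelabelLink j (L i)), ?_, fun l => ?_, rfl, ?_⟩
    · rw [Fin.cons_injective_iff]
      refine ⟨?_, (unrelabelLink_injective j).comp hinj⟩
      rintro ⟨i, hi⟩
      exact unrelabelLink_ne _ _ hi
    · rw [α.mem_iff_of_remove hj, Fin.exists_fin_succ]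
      simp only [hmem, Fin.cons_zero, Fin.cons_succ]
      rw [eq_comm]
      simp
    · simpa only [Fin.cons_zero, Fin.cons_succ, relabelLink_unrelabelLink] using hrem

theorem LinkPattern.exists_allowable {N : ℕ} (α : LinkPattern N) :
    ∃ σ : α.Ordering, α.Allowable σ := by
  obtain ⟨L, hinj, hmem, hrem⟩ := exists_removable α
  refine ⟨Equiv.ofBijective (fun i => ⟨L i, (hmem _).mpr ⟨i, rfl⟩⟩) ⟨?_, ?_⟩, hrem⟩
  · intro i j h
    exact hinj (congrArg Subtype.val h)
  · rintro ⟨l, hl⟩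
    obtain ⟨i, rfl⟩ := (hmem l).mp hl
    exact ⟨i, rfl⟩

theorem LinkPattern.Allowable.isIterProj {N : ℕ} {α : LinkPattern N} {σ : α.Ordering}
    (hσ : α.Allowable σ) : IsIterProj q N α (iterProj q N (fun i => (σ i : ℕ × ℕ))) := by
  refine isIterProj_iterProj α _ (Subtype.val_injective.comp σ.injective) (fun l => ?_) hσ
  constructor
  · intro hl
    exact ⟨σ.symm ⟨l, hl⟩, by simp⟩
  · rintro ⟨i, rfl⟩
    exact (σ i).2

/-- A vector of the trivial subrepresentation is determined by its iterated projections. -/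
theorem eq_zero_of_isIterProj : ∀ {N : ℕ} {v : TPow (2 * N)}, v ∈ H1 q (2 * N) →
    (∀ (α : LinkPattern N) (f : TPow (2 * N) →ₗ[ℂ] ℂ), IsIterProj q N α f → f v = 0) → v = 0
  | 0, v, _, h => by
    have := h LinkPattern.empty _ rfl
    exact scalar.injective (by simpa using this)
  | N + 1, v, hv, h => by
    -- It suffices that every `π̂_j v` vanishes. An iterated projection along `β` after `π̂_j` is
    -- one along `β` with `(j, j + 1)` inserted, so induction applies.
    refine ProjFree.eq_zero (n := 2 * N + 1) (q := q) (fun j h1 h2 => ?_) hv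
    refine eq_zero_of_isIterProj (piHat_mem_H1 q j hv) fun β g hg => ?_
    have hmem := β.mem_insertLink j h1 h2
    exact h (β.insertLink j h1 h2) (g ∘ₗ piHat q (2 * N) j)
      ⟨j, hmem, g, by rwa [β.remove_insertLink], rfl⟩

variable (q)

/-! ## Weight spaces -/

/-- The weight space of weight `q ^ m`. -/
def weightSpace (n : ℕ) (m : ℤ) : Submodule ℂ (TPow n) :=
  Module.End.eigenspace (rep q n (gen q Gen.K)) ((q : ℂ) ^ m)

variable {q}

theorem mem_weightSpace {n : ℕ} {m : ℤ} {v : TPow n} :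
    v ∈ weightSpace q n m ↔ rep q n (gen q Gen.K) v = (q : ℂ) ^ m • v :=
  Module.End.mem_eigenspace_iff

theorem DefParam.zpow_eq_one {m : ℤ} (h : (q : ℂ) ^ m = 1) : m = 0 := by
  by_contra hm
  refine q.2.2 m.natAbs (Int.natAbs_pos.mpr hm) ?_
  rcases Int.natAbs_eq m with h' | h'
  · rw [← zpow_natCast, ← h', h]
  · rw [h', zpow_neg, inv_eq_one] at h
    rwa [← zpow_natCast]

instance (n : ℕ) : Module.Finite ℂ (TPow n) := by
  induction n with
  | zero => exact Module.Finite.equiv scalar.symm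
  | succ n ih => exact Module.Finite.equiv (components n).symm

theorem mem_weightSpace_succ {n : ℕ} {m : ℤ} {v : TPow (n + 1)} :
    v ∈ weightSpace q (n + 1) m ↔ components n v 0 ∈ weightSpace q n (m - 1) ∧
      components n v 1 ∈ weightSpace q n (m + 1) := by
  have hq := q.ne_zero
  have key : ∀ (c d : ℂ) (x y : TPow n), c ≠ 0 → (c • x = d • y ↔ x = (d / c) • y) := by
    intro c d x y hc
    rw [div_eq_inv_mul, mul_smul]
    exact (eq_inv_smul_iff₀ hc).symm
  simp only [mem_weightSpace]
  rw [zpow_sub_one₀ hq, zpow_add_one₀ hq]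
  rw [← div_eq_mul_inv, ← div_inv_eq_mul, ← key _ _ _ _ hq, ← key _ _ _ _ (inv_ne_zero hq),
    ← components_K_zero, ← components_K_one]
  constructor
  · intro h
    rw [h, map_smul]
    exact ⟨rfl, rfl⟩
  · rintro ⟨h0, h1⟩
    apply ext_components
    · rw [h0, map_smul]; rfl
    · rw [h1, map_smul]; rfl

/-- The decomposition of a weight space along the rightmost tensorand. -/
def weightSpaceEquiv (q : DefParam) (n : ℕ) (m : ℤ) :
    weightSpace q (n + 1) m ≃ₗ[ℂ] weightSpace q n (m - 1) × weightSpace q n (m + 1) where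
  toFun v := (⟨_, (mem_weightSpace_succ.mp v.2).1⟩, ⟨_, (mem_weightSpace_succ.mp v.2).2⟩)
  invFun x := ⟨(components n).symm ![x.1, x.2], by simp [mem_weightSpace_succ]⟩
  map_add' v w := by ext <;> simp
  map_smul' c v := by ext <;> simp
  left_inv v := by
    ext1
    apply ext_components <;> simp
  right_inv x := by ext <;> simp

theorem finrank_eq_add_of_equiv_prod {V W W' : Type*} [AddCommGroup V] [Module ℂ V]
    [AddCommGroup W] [Module ℂ W] [AddCommGroup W'] [Module ℂ W'] [Module.Finite ℂ W]
    [Module.Finite ℂ W'] (f : V ≃ₗ[ℂ] W × W') :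
    Module.finrank ℂ V = Module.finrank ℂ W + Module.finrank ℂ W' := by
  rw [f.finrank_eq, Module.finrank_prod]

theorem finrank_weightSpace_succ (n : ℕ) (m : ℤ) :
    Module.finrank ℂ (weightSpace q (n + 1) m) =
      Module.finrank ℂ (weightSpace q n (m - 1)) + Module.finrank ℂ (weightSpace q n (m + 1)) :=
  finrank_eq_add_of_equiv_prod (V := weightSpace q (n + 1) m) (W := weightSpace q n (m - 1))
    (W' := weightSpace q n (m + 1)) (weightSpaceEquiv q n m)

theorem finrank_weightSpace_zero (m : ℤ) :
    Module.finrank ℂ (weightSpace q 0 m) = if m = 0 then 1 else 0 := by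
  split_ifs with h
  · have : weightSpace q 0 m = ⊤ := by
      rw [eq_top_iff]
      intro v _
      simp [mem_weightSpace, h]
    rw [this, finrank_top, scalar.finrank_eq, Module.finrank_self]
  · have : weightSpace q 0 m = ⊥ := by
      rw [eq_bot_iff]
      intro v hv
      rw [mem_weightSpace, rep_zero_K] at hv
      exact eq_zero_of_smul_eq_self (fun h' => h (DefParam.zpow_eq_one h')) hv.symm
    rw [this, finrank_bot]

theorem finrank_weightSpace_of_lt : ∀ (n : ℕ) (m : ℤ), (n : ℤ) < m →
    Module.finrank ℂ (weightSpace q n m) = 0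
  | 0, m, h => by rw [finrank_weightSpace_zero, if_neg (by simp at h; omega)]
  | n + 1, m, h => by
    push_cast at h
    rw [finrank_weightSpace_succ, finrank_weightSpace_of_lt n _ (by omega),
      finrank_weightSpace_of_lt n _ (by omega)]

/-- Splitting off the rightmost tensorand is Pascal's rule. -/
theorem finrank_weightSpace : ∀ (n k : ℕ),
    Module.finrank ℂ (weightSpace q n (n - 2 * k)) = n.choose k
  | 0, k => by
    rw [finrank_weightSpace_zero]
    cases k <;> simp; omega
  | n + 1, 0 => by
    have h0 := finrank_weightSpace n 0
    -- The exponent `n + 2` exceeds the top weight `n`.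
    have h1 : Module.finrank ℂ (weightSpace q n (n + 2)) = 0 :=
      finrank_weightSpace_of_lt n _ (by omega)
    rw [finrank_weightSpace_succ,
      show ((n + 1 : ℕ) : ℤ) - 2 * (0 : ℕ) - 1 = n - 2 * (0 : ℕ) by push_cast; ring,
      show ((n + 1 : ℕ) : ℤ) - 2 * (0 : ℕ) + 1 = n + 2 by push_cast; ring, h0, h1]
    simp
  | n + 1, k + 1 => by
    rw [finrank_weightSpace_succ,
      show ((n + 1 : ℕ) : ℤ) - 2 * (k + 1 : ℕ) - 1 = n - 2 * (k + 1 : ℕ) by push_cast; ring,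
      show ((n + 1 : ℕ) : ℤ) - 2 * (k + 1 : ℕ) + 1 = n - 2 * k by push_cast; ring,
      finrank_weightSpace n k, finrank_weightSpace n (k + 1), Nat.choose_succ_succ', add_comm]

theorem rep_E_mem_weightSpace {n : ℕ} {m : ℤ} {v : TPow n} (hv : v ∈ weightSpace q n m) :
    rep q n (gen q Gen.E) v ∈ weightSpace q n (m + 2) := by
  rw [mem_weightSpace] at hv ⊢
  have h := congrArg (fun x => rep q n x v) (K_E q)
  simp only [map_mul, map_smul, Module.End.mul_apply, LinearMap.smul_apply] at h
  rw [h, hv, map_smul, smul_smul, zpow_add₀ q.ne_zero, mul_comm]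
  rfl

/-- The raising operator from weight zero to weight two. -/
def raise (q : DefParam) (n : ℕ) : weightSpace q n 0 →ₗ[ℂ] weightSpace q n (0 + 2) :=
  (rep q n (gen q Gen.E)).restrict fun _ hv => rep_E_mem_weightSpace hv

theorem map_ker_raise (n : ℕ) :
    (LinearMap.ker (raise q n)).map (weightSpace q n 0).subtype = H1 q n := by
  ext v
  simp only [Submodule.mem_map, LinearMap.mem_ker, Submodule.subtype_apply]
  constructor
  · rintro ⟨w, hw, rfl⟩
    refine ⟨congrArg Subtype.val hw, ?_⟩
    have := mem_weightSpace.mp w.2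
    rwa [zpow_zero, one_smul] at this
  · rintro ⟨hE, hK⟩
    refine ⟨⟨v, ?_⟩, Subtype.ext hE, rfl⟩
    rw [mem_weightSpace, zpow_zero, one_smul, hK]

theorem choose_eq_catalan_add_choose (N : ℕ) :
    (2 * (N + 1)).choose (N + 1) = catalan (N + 1) + (2 * (N + 1)).choose N := by
  have h1 := succ_mul_catalan_eq_centralBinom (N + 1)
  rw [Nat.centralBinom] at h1
  have h2 := Nat.choose_succ_right_eq (2 * (N + 1)) N
  rw [show 2 * (N + 1) - N = N + 2 by omega] at h2
  have h3 : (N + 2) * (2 * (N + 1)).choose (N + 1)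
      = (N + 2) * (catalan (N + 1) + (2 * (N + 1)).choose N) := by
    linarith
  exact Nat.eq_of_mul_eq_mul_left (by omega) h3

/-- `H1` is the kernel of `raise`, whose source and target have dimensions `C(2N, N)` and `C(2N, N -
1)` for `N ≥ 1`; rank-nullity bounds the kernel below by the difference, a Catalan number. -/
theorem catalan_le_finrank_H1 (N : ℕ) : catalan N ≤ Module.finrank ℂ (H1 q (2 * N)) := by
  rw [← map_ker_raise, ← (Submodule.equivMapOfInjective _ (Submodule.subtype_injective _)
    (LinearMap.ker (raise q (2 * N)))).finrank_eq]
  have h := LinearMap.finrank_range_add_finrank_ker (V := weightSpace q (2 * N) 0)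
    (V₂ := weightSpace q (2 * N) (0 + 2)) (raise q (2 * N))
  have hle := (LinearMap.range (raise q (2 * N))).finrank_le
  have h0 := finrank_weightSpace (q := q) (2 * N) N
  rw [show ((2 * N : ℕ) : ℤ) - 2 * N = 0 by push_cast; ring] at h0
  rw [h0] at h
  obtain _ | N := N
  -- For `N = 0` the target is zero.
  · rw [finrank_weightSpace_of_lt _ _ (by simp)] at hle
    rw [Nat.choose_zero_right] at h
    rw [catalan_zero]
    omega
  · have h2 := finrank_weightSpace (q := q) (2 * (N + 1)) N
    rw [show ((2 * (N + 1) : ℕ) : ℤ) - 2 * N = 0 + 2 by push_cast; ring] at h2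
    rw [h2] at hle
    rw [choose_eq_catalan_add_choose] at h
    omega

end

/-! ## Dual bases -/

/-- Joint evaluation is injective because the functionals separate points, and the dimension bound
makes it bijective. -/
theorem exists_equiv_of_separating {V ι : Type*} [AddCommGroup V] [Module ℂ V] [Fintype ι]
    (φ : ι → Module.Dual ℂ V) (hφ : ∀ v, (∀ i, φ i v = 0) → v = 0)
    (hcard : Fintype.card ι ≤ Module.finrank ℂ V) :
    Module.finrank ℂ V = Fintype.card ι ∧ ∃ f : V ≃ₗ[ℂ] (ι → ℂ), ∀ v i, f v i = φ i v := by
  have hinj : Function.Injective (LinearMap.pi φ) := by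
    rw [← LinearMap.ker_eq_bot, LinearMap.ker_eq_bot']
    exact fun v hv => hφ v fun i => congrFun hv i
  have hfin : Module.Finite ℂ V := Module.Finite.of_injective _ hinj
  have hle := LinearMap.finrank_le_finrank_of_injective hinj
  rw [Module.finrank_fintype_fun_eq_card] at hle
  have heq := le_antisymm hle hcard
  exact ⟨heq, LinearMap.linearEquivOfInjective _ hinj
    (by rw [heq, Module.finrank_fintype_fun_eq_card]), fun v i => rfl⟩

theorem exists_dual_vectors {V ι : Type*} [AddCommGroup V] [Module ℂ V] [Fintype ι]
    [DecidableEq ι] (φ : ι → Module.Dual ℂ V) (hφ : ∀ v, (∀ i, φ i v = 0) → v = 0)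
    (hcard : Fintype.card ι ≤ Module.finrank ℂ V) :
    ∃ w : ι → V, ∀ i j, φ i (w j) = if i = j then 1 else 0 := by
  obtain ⟨-, f, hf⟩ := exists_equiv_of_separating φ hφ hcard
  refine ⟨fun j => f.symm (Pi.single j 1), fun i j => ?_⟩
  rw [← hf, LinearEquiv.apply_symm_apply, Pi.single_apply]

theorem exists_bases_of_dual {V ι : Type*} [AddCommGroup V] [Module ℂ V] [Fintype ι]
    [DecidableEq ι] (φ : ι → Module.Dual ℂ V) (hφ : ∀ v, (∀ i, φ i v = 0) → v = 0)
    (hcard : Fintype.card ι ≤ Module.finrank ℂ V) (w : ι → V)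
    (hw : ∀ i j, φ i (w j) = if i = j then 1 else 0) :
    (∃ b : Module.Basis ι ℂ V, ∀ i, b i = w i) ∧
      ∃ b : Module.Basis ι ℂ (Module.Dual ℂ V), ∀ i, b i = φ i := by
  obtain ⟨-, f, hf⟩ := exists_equiv_of_separating φ hφ hcard
  have hb : ∀ i, Module.Basis.ofEquivFun f i = w i := by
    intro j
    rw [Module.Basis.coe_ofEquivFun, LinearEquiv.symm_apply_eq]
    ext i
    rw [hf, hw, Pi.single_apply]
  refine ⟨⟨_, hb⟩, (Module.Basis.ofEquivFun f).dualBasis, fun i => ?_⟩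
  refine (Module.Basis.ofEquivFun f).ext fun j => ?_
  rw [Module.Basis.dualBasis_apply_self, hb, hw]
  simp only [eq_comm]

/-! ## The pure system -/

variable {q : DefParam}

/-- The iterated projections of a pure system. -/
theorem IsPureSystem.apply_eq {v : (N : ℕ) → LinkPattern N → TPow (2 * N)}
    (hv : IsPureSystem q v) : ∀ {N : ℕ} (α β : LinkPattern N) (f : TPow (2 * N) →ₗ[ℂ] ℂ),
    IsIterProj q N α f → f (v N β) = if α = β then 1 else 0
  | 0, α, β, f, h => by
    rw [show f = scalar.toLinearMap from h, Subsingleton.elim α β, if_pos rfl,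
      Subsingleton.elim β LinkPattern.empty]
    exact hv.normalized
  | N + 1, α, β, f, ⟨j, hj, g, hg, hf⟩ => by
    have hr := α.range _ hj
    simp only at hr
    rw [hf]
    change g (piHat q (2 * N) j (v (N + 1) β)) = _
    by_cases hβ : (j, j + 1) ∈ β.links
    · rw [hv.proj_of_mem N β j hβ, hv.apply_eq _ _ g hg]
      refine if_congr ⟨LinkPattern.remove_injective hj hβ, ?_⟩ rfl rfl
      rintro rfl
      rfl
    · rw [hv.proj_of_notMem N β j hr.1 (by omega) hβ, map_zero, if_neg]
      rintro rfl
      exact hβ hj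

/-- Vectors of the trivial subrepresentation with the same iterated projections agree. -/
theorem eq_of_isIterProj {N : ℕ} {v w : TPow (2 * N)} (hv : v ∈ H1 q (2 * N))
    (hw : w ∈ H1 q (2 * N))
    (h : ∀ (α : LinkPattern N) (f : TPow (2 * N) →ₗ[ℂ] ℂ), IsIterProj q N α f → f v = f w) :
    v = w := by
  rw [← sub_eq_zero]
  refine eq_zero_of_isIterProj ((H1 q (2 * N)).sub_mem hv hw) fun α f hf => ?_
  rw [map_sub, h α f hf, sub_self]

/-- The defining equations alone fix every iterated projection of `v_α`, and these determine a
vector of `H1`. -/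
theorem IsPureSystem.unique {v w : (N : ℕ) → LinkPattern N → TPow (2 * N)}
    (hv : IsPureSystem q v) (hw : IsPureSystem q w) : v = w := by
  funext N α
  refine eq_of_isIterProj (hv.mem_H1 N α) (hw.mem_H1 N α) fun β f hf => ?_
  rw [hv.apply_eq β α f hf, hw.apply_eq β α f hf]

/-- One iterated projection per pattern is enough, as any other along the same pattern coincides
with it. -/
theorem separating_of_isIterProj {N : ℕ} (φ : LinkPattern N → Module.Dual ℂ (H1 q (2 * N)))
    (hφ : ∀ α, ∃ f, IsIterProj q N α f ∧ φ α = f ∘ₗ (H1 q (2 * N)).subtype)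
    (v : H1 q (2 * N)) (hv : ∀ α, φ α v = 0) : v = 0 := by
  refine Subtype.ext (eq_zero_of_isIterProj v.2 fun α f hf => ?_)
  obtain ⟨g, hg, hgφ⟩ := hφ α
  have := hv α
  rw [hgφ, hg.unique _ _ _ hf] at this
  exact this

theorem card_le_finrank_H1 (N : ℕ) :
    Fintype.card (LinkPattern N) ≤ Module.finrank ℂ (H1 q (2 * N)) :=
  (LinkPattern.card_le_catalan N).trans (catalan_le_finrank_H1 N)

variable (q) in
theorem exists_dual_to_isIterProj (N : ℕ) : ∃ w : LinkPattern N → TPow (2 * N),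
    (∀ α, w α ∈ H1 q (2 * N)) ∧ ∀ (α β : LinkPattern N) (f : TPow (2 * N) →ₗ[ℂ] ℂ),
      IsIterProj q N α f → f (w β) = if α = β then 1 else 0 := by
  choose f hf using fun α : LinkPattern N => exists_isIterProj q α
  obtain ⟨w, hw⟩ := exists_dual_vectors (V := H1 q (2 * N))
    (fun α => f α ∘ₗ (H1 q (2 * N)).subtype)
    (separating_of_isIterProj _ fun α => ⟨f α, hf α, rfl⟩) (card_le_finrank_H1 N)
  refine ⟨fun α => w α, fun α => (w α).2, fun α β g hg => ?_⟩
  rw [hg.unique _ _ _ (hf α)]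
  exact hw α β

-- The vectors are chosen for each `N` separately, as dual vectors to the iterated projections. The
-- equations between levels then hold because both sides lie in `H1` and have equal iterated
-- projections: preceding one along `β` by `π̂_j` gives one along `β.insertLink j`, and
-- `β.insertLink j = α` exactly when `(j, j + 1)` is a link of `α` with quotient `β`.
variable (q) in
theorem exists_isPureSystem :
    ∃ v : (N : ℕ) → LinkPattern N → TPow (2 * N), IsPureSystem q v := by
  choose v hmem hdual using exists_dual_to_isIterProj q
  have key : ∀ (N : ℕ) (α : LinkPattern (N + 1)) (j : ℕ) (h1 : 1 ≤ j) (h2 : j ≤ 2 * N + 1)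
      (β : LinkPattern N) (f : TPow (2 * N) →ₗ[ℂ] ℂ), IsIterProj q N β f →
      f (piHat q (2 * N) j (v (N + 1) α)) = if β.insertLink j h1 h2 = α then 1 else 0 := by
    intro N α j h1 h2 β f hf
    exact hdual (N + 1) (β.insertLink j h1 h2) α (f ∘ₗ piHat q (2 * N) j)
      ⟨j, β.mem_insertLink j h1 h2, f, by rwa [β.remove_insertLink], rfl⟩
  refine ⟨v, fun N α => (hmem N α).2, fun N α => (hmem N α).1, ?_, ?_, ?_⟩
  · intro N α j h1 h2 hj
    refine eq_of_isIterProj (piHat_mem_H1 q j (hmem (N + 1) α)) (H1 q (2 * N)).zero_mem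
      fun β f hf => ?_
    rw [key N α j h1 (by omega) β f hf, map_zero, if_neg]
    rintro rfl
    exact hj (β.mem_insertLink j h1 _)
  · intro N α j hj
    have hr := α.range _ hj
    simp only at hr
    refine eq_of_isIterProj (piHat_mem_H1 q j (hmem (N + 1) α)) (hmem N _) fun β f hf => ?_
    rw [key N α j hr.1 (by omega) β f hf, hdual N β _ f hf]
    refine if_congr ⟨?_, ?_⟩ rfl rfl
    · rintro rfl
      exact (β.remove_insertLink j _ _).symm
    · intro h
      refine LinkPattern.remove_injective (β.mem_insertLink j _ _) hj ?_
      rw [β.remove_insertLink, h]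
  · exact (hdual 0 _ _ _ rfl).trans (if_pos rfl)

theorem isIterProj_psi {N : ℕ} {α : LinkPattern N} {φ : Module.Dual ℂ (H1 q (2 * N))}
    (hφ : ∃ σ : α.Ordering, α.Allowable σ ∧ φ = psi q α σ) :
    ∃ f, IsIterProj q N α f ∧ φ = f ∘ₗ (H1 q (2 * N)).subtype := by
  obtain ⟨σ, hσ, rfl⟩ := hφ
  exact ⟨_, hσ.isIterProj, rfl⟩

theorem psi_eq_psi {N : ℕ} {α : LinkPattern N} {σ σ' : α.Ordering} (hσ : α.Allowable σ)
    (hσ' : α.Allowable σ') : psi q α σ = psi q α σ' := by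
  rw [psi, psi, hσ.isIterProj.unique _ _ _ hσ'.isIterProj]

theorem finrank_H1 (q : DefParam) (N : ℕ) : Module.finrank ℂ (H1 q (2 * N)) = catalan N := by
  choose f hf using fun α : LinkPattern N => exists_isIterProj q α
  have h := (exists_equiv_of_separating (V := H1 q (2 * N))
    (fun α => f α ∘ₗ (H1 q (2 * N)).subtype)
    (separating_of_isIterProj _ fun α => ⟨f α, hf α, rfl⟩) (card_le_finrank_H1 N)).1
  exact le_antisymm (h.le.trans (LinkPattern.card_le_catalan N)) (catalan_le_finrank_H1 N)

end

end PureSLE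

/-! ### Existence, uniqueness and duality -/

theorem mainTheorem5 (κ : ℝ) (hpos : 0 < κ) (hlt : κ < 8) (hirr : Irrational κ)
    (q : PureSLE.DefParam) (hq : q = PureSLE.qOf κ hirr) :
    (∃! v : (N : ℕ) → PureSLE.LinkPattern N → PureSLE.TPow (2 * N),
      PureSLE.IsPureSystem q v) ∧
    ∀ (v : (N : ℕ) → PureSLE.LinkPattern N → PureSLE.TPow (2 * N))
      (hv : PureSLE.IsPureSystem q v) (N : ℕ),
      (∀ α : PureSLE.LinkPattern N,
        (∃ σ : α.Ordering, α.Allowable σ) ∧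
        ∀ σ σ' : α.Ordering, α.Allowable σ → α.Allowable σ' →
          PureSLE.psi q α σ = PureSLE.psi q α σ') ∧
      (∀ ψ : PureSLE.LinkPattern N → Module.Dual ℂ (PureSLE.H1 q (2 * N)),
        (∀ α, ∃ σ : α.Ordering, α.Allowable σ ∧ ψ α = PureSLE.psi q α σ) →
        (∀ α β : PureSLE.LinkPattern N,
          ψ α ⟨v N β, hv.mem_H1 N β⟩ = if α = β then 1 else 0) ∧
        (∃ b : Module.Basis (PureSLE.LinkPattern N) ℂ (PureSLE.H1 q (2 * N)),
          ∀ α, b α = ⟨v N α, hv.mem_H1 N α⟩) ∧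
        (∃ b' : Module.Basis (PureSLE.LinkPattern N) ℂ
            (Module.Dual ℂ (PureSLE.H1 q (2 * N))),
          ∀ α, b' α = ψ α)) ∧
      Module.finrank ℂ (PureSLE.H1 q (2 * N)) = catalan N ∧
      Module.finrank ℂ (Module.Dual ℂ (PureSLE.H1 q (2 * N))) = catalan N := by
  refine ⟨?_, fun v hv N => ⟨fun α => ⟨α.exists_allowable, fun σ σ' => PureSLE.psi_eq_psi⟩,
    fun ψ hψ => ?_, PureSLE.finrank_H1 q N,
    (Subspace.dual_finrank_eq (V := PureSLE.H1 q (2 * N))).trans (PureSLE.finrank_H1 q N)⟩⟩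
  · obtain ⟨v, hv⟩ := PureSLE.exists_isPureSystem q
    exact ⟨v, hv, fun w hw => hw.unique hv⟩
  · have hiter := fun α => PureSLE.isIterProj_psi (hψ α)
    have hpair : ∀ α β : PureSLE.LinkPattern N,
        ψ α ⟨v N β, hv.mem_H1 N β⟩ = if α = β then 1 else 0 := by
      intro α β
      obtain ⟨f, hf, h⟩ := hiter α
      rw [h]
      exact hv.apply_eq α β f hf
    exact ⟨hpair, PureSLE.exists_bases_of_dual (V := PureSLE.H1 q (2 * N)) ψ
      (PureSLE.separating_of_isIterProj ψ hiter) (PureSLE.card_le_finrank_H1 N) _ hpair⟩
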